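/- Let $M\subset\mathbb{R}^3$ be a $C^2$-smooth strictly convex closed surface, that is, a $C^2$-smooth compact surface which is the boundary of a strictly convex body $K$ (compact, with nonempty interior). For a point $x$ in the exterior $\mathbb{R}^3\setminus K$ of $M$, a tangent segment from $x$ to $M$ is a segment $[x,p]$ with $p\in M$ that is tangent to $M$ at $p$. Let $H$ be the set of all points $x$ in the exterior of $M$ such that all the tangent segments from $x$ to $M$ have equal lengths. Suppose that $H$ contains at least one of the following: (i) a closed surface $S$ (a compact connected topological $2$-manifold without boundary embedded in $\mathbb{R}^3$) that contains $M$ in its interior, i.e. such that $M$ lies in the bounded part of $\mathbb{R}^3\setminus S$; (ii) a plane; (iii) the union of three distinct lines. Then $M$ is a round sphere. -/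

import Mathlib

open Set Filter Topology

/-- Euclidean three-space. -/
abbrev E3 : Type := EuclideanSpace ℝ (Fin 3)

/-- `M` is a `C²`-smooth embedded surface (without boundary) in three-space: near each of its points
it is the zero set of a `C²` function with nonvanishing differential. -/
def IsC2Surface (M : Set E3) : Prop :=
  ∀ p ∈ M, ∃ (U : Set E3) (f : E3 → ℝ), IsOpen U ∧ p ∈ U ∧ ContDiffOn ℝ 2 f U ∧
    (∀ q ∈ U, fderiv ℝ f q ≠ 0) ∧ M ∩ U = {q ∈ U | f q = 0}

/-- The region bounded by a closed convex surface, surface included: its convex hull. -/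
def convexBody (M : Set E3) : Set E3 := convexHull ℝ M

/-- `M` is a `C²`-smooth strictly convex closed surface: a compact `C²` surface which is the boundary
of a strictly convex body (with nonempty interior); this body is then the convex hull of `M`. -/
structure IsC2StrictlyConvexClosedSurface (M : Set E3) : Prop where
  isC2Surface : IsC2Surface M
  isCompact : IsCompact M
  strictConvex : StrictConvex ℝ (convexBody M)
  interior_nonempty : (interior (convexBody M)).Nonempty
  eq_frontier : M = frontier (convexBody M)

/-- The vector `v` is tangent to `M` at `p`: it is the velocity at `p` of a curve lying on `M`. -/
def IsTangentVector (M : Set E3) (p v : E3) : Prop :=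
  ∃ c : ℝ → E3, c 0 = p ∧ (∀ᶠ t in 𝓝 (0 : ℝ), c t ∈ M) ∧ HasDerivAt c v 0

/-- The contact points with `M` of the tangents from `x`: the points `p` of `M` such that the
segment from `x` to `p` is tangent to `M` at `p`. The tangent segments from `x` to `M` are the
segments from `x` to these points. -/
def contactSet (M : Set E3) (x : E3) : Set E3 :=
  {p ∈ M | IsTangentVector M p (p - x)}

/-- The set of points in the exterior of the closed convex surface `M` from which all the tangent
segments to `M` have equal lengths. -/
def equitangentSet (M : Set E3) : Set E3 :=
  {x | x ∉ convexBody M ∧ ∀ p ∈ contactSet M x, ∀ q ∈ contactSet M x, dist x p = dist x q}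

/-- `S` is a closed surface in three-space: a compact connected subset that is, in the subspace
topology, a topological manifold of dimension two (without boundary). -/
structure IsClosedSurface (S : Set E3) : Prop where
  isCompact : IsCompact S
  isConnected : IsConnected S
  isManifold : Nonempty (ChartedSpace (EuclideanSpace ℝ (Fin 2)) S)

/-- The interior of a closed surface `S`: the points of the complement of `S` whose connected
component in this complement is bounded. -/
def surfaceInterior (S : Set E3) : Set E3 :=
  {p | p ∉ S ∧ Bornology.IsBounded (connectedComponentIn Sᶜ p)}

open scoped RealInnerProductSpace

/-! Let `x` lie in `equitangentSet M` and let `p` be a contact point of a tangent from `x`. Near `p`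
the points with `f q = 0` and `⟪ν q, q - x⟫ = 0` are contact points, so the distance to `x` is
constant on them, and the Lagrange multiplier rule makes `p - x` a principal direction
(`IsNormalChart.isPrincipalDirection`). This yields umbilicity everywhere.

If a surface in the equitangent set encloses `M`, each tangent ray at `p` hits it, so every tangent
direction is principal. A plane contains three concurrent lines. For three lines, the tangent plane
at a generic `p` meets them in three points seen from `p` in pairwise independent directions, and
three principal directions force an umbilic (`isUmbilic_of_three_directions`); continuity covers the
other points. Genericity holds because, if the directions towards two lines agreed on an open part
of `M`, a section of `M` by a plane through the first line would have infinitely many tangents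
through the point where the second line crosses that plane, while a strictly convex curve has at
most two (`not_three_contacts_in_plane`).

As `ν` is only `C¹`, the curvature cannot be differentiated to get a sphere. Instead, for `p, q ∈ M`
and `e` orthogonal to `p - q`, the function `⟪n, e⟫` is constant along an arc of `M` from `q` to `p`
in a plane orthogonal to `e`. So `n p - n q` is a multiple of `p - q`; no three points of `M` are
collinear, so the ratio `μ` is the same for all pairs, and `p - μ⁻¹ • n p` is the centre
(`exists_eq_sphere_of_isUmbilic`). -/

/-- `ν` is an outer unit normal of the set `K` at the point `p`. -/
def IsOuterNormal (K : Set E3) (p ν : E3) : Prop :=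
  ‖ν‖ = 1 ∧ ∀ y ∈ K, ⟪ν, y - p⟫ ≤ 0

/-- On the open set `U`, the set `M` is the zero set of `f`, whose gradient is a nonzero multiple of
the `C¹` unit field `ν`, and `ν` is the outer normal of the convex hull of `M` along `M`. -/
structure IsNormalChart (M U : Set E3) (f : E3 → ℝ) (ν : E3 → E3) : Prop where
  isOpen : IsOpen U
  contDiffAt : ∀ q ∈ U, ContDiffAt ℝ 1 ν q
  norm_eq_one : ∀ q ∈ U, ‖ν q‖ = 1
  hasStrictFDerivAt : ∀ q ∈ U, ∃ c : ℝ, c ≠ 0 ∧ HasStrictFDerivAt f (c • innerSL ℝ (ν q)) q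
  mem_iff : ∀ q ∈ U, q ∈ M ↔ f q = 0
  eq_of_isOuterNormal : ∀ q ∈ U, q ∈ M → ∀ n, IsOuterNormal (convexBody M) q n → n = ν q

/-! ### Outer normals of the body and normal charts. -/

theorem convex_convexBody (M : Set E3) : Convex ℝ (convexBody M) := convex_convexHull ℝ M

theorem subset_convexBody (M : Set E3) : M ⊆ convexBody M := subset_convexHull ℝ M

namespace IsC2StrictlyConvexClosedSurface

variable {M : Set E3}

theorem isCompact_convexBody (hM : IsC2StrictlyConvexClosedSurface M) : IsCompact (convexBody M) := by
  have hb : Bornology.IsBounded (convexBody M) := isBounded_convexHull.2 hM.isCompact.isBounded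
  refine Metric.isCompact_of_isClosed_isBounded ?_ hb
  rw [← closure_eq_iff_isClosed, closure_eq_self_union_frontier, ← hM.eq_frontier]
  exact union_eq_self_of_subset_right (subset_convexBody M)

theorem notMem_interior (hM : IsC2StrictlyConvexClosedSurface M) {p : E3} (hp : p ∈ M) :
    p ∉ interior (convexBody M) := by
  rw [hM.eq_frontier] at hp
  exact hp.2

theorem isOuterNormal_of_forall_lt (hM : IsC2StrictlyConvexClosedSurface M) {p v : E3}
    (hv : ∀ y ∈ interior (convexBody M), ⟪v, y⟫ < ⟪v, p⟫) :
    v ≠ 0 ∧ IsOuterNormal (convexBody M) p (‖v‖⁻¹ • v) := by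
  obtain ⟨o, ho⟩ := hM.interior_nonempty
  have hle : ∀ y ∈ convexBody M, ⟪v, y - p⟫ ≤ 0 := by
    intro y hy
    have h1 : y ∈ closure (interior (convexBody M)) := by
      rw [(convex_convexBody M).closure_interior_eq_closure_of_nonempty_interior
        hM.interior_nonempty]
      exact subset_closure hy
    have h2 : IsClosed {y : E3 | ⟪v, y - p⟫ ≤ 0} := isClosed_le (by fun_prop) (by fun_prop)
    refine closure_minimal ?_ h2 h1
    intro z hz
    have := hv z hz
    simp only [mem_ofPred_eq, inner_sub_right]
    linarith
  have hv0 : v ≠ 0 := by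
    rintro rfl
    simpa using hv o ho
  have hn : 0 < ‖v‖ := norm_pos_iff.2 hv0
  refine ⟨hv0, ?_, fun y hy => ?_⟩
  · rw [norm_smul, norm_inv, norm_norm, inv_mul_cancel₀ hn.ne']
  · rw [real_inner_smul_left]
    exact mul_nonpos_of_nonneg_of_nonpos (by positivity) (hle y hy)

theorem exists_isOuterNormal (hM : IsC2StrictlyConvexClosedSurface M) {p : E3} (hp : p ∈ M) :
    ∃ n, IsOuterNormal (convexBody M) p n := by
  obtain ⟨f, hf⟩ := geometric_hahn_banach_open_point (convex_convexBody M).interior isOpen_interior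
    (hM.notMem_interior hp)
  refine ⟨_, (hM.isOuterNormal_of_forall_lt
    (v := (InnerProductSpace.toDual ℝ E3).symm f) fun y hy => ?_).2⟩
  simpa using hf y hy

theorem _root_.IsOuterNormal.inner_neg_of_mem_interior {K : Set E3} {p n o : E3}
    (hn : IsOuterNormal K p n) (ho : o ∈ interior K) : ⟪n, o - p⟫ < 0 := by
  obtain ⟨ε, hε, hb⟩ := Metric.isOpen_iff.1 isOpen_interior o ho
  have h1 : o + (ε / 2) • n ∈ K := by
    apply interior_subset
    apply hb
    rw [Metric.mem_ball, dist_eq_norm]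
    simp only [add_sub_cancel_left, norm_smul, hn.1, Real.norm_eq_abs, mul_one]
    rw [abs_of_pos (by positivity)]
    linarith
  have h2 := hn.2 _ h1
  have h3 : ⟪n, o + (ε / 2) • n - p⟫ = ⟪n, o - p⟫ + ε / 2 := by
    rw [add_sub_right_comm, inner_add_right, real_inner_smul_right, real_inner_self_eq_norm_sq,
      hn.1]
    ring
  linarith

theorem inner_neg (hM : IsC2StrictlyConvexClosedSurface M) {p n y : E3} (hp : p ∈ M)
    (hn : IsOuterNormal (convexBody M) p n) (hy : y ∈ convexBody M) (hyp : y ≠ p) : ⟪n, y - p⟫ < 0 := by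
  have h1 : (1 / 2 : ℝ) • y + (1 / 2 : ℝ) • p ∈ interior (convexBody M) :=
    hM.strictConvex hy (subset_convexBody M hp) hyp (by norm_num) (by norm_num) (by norm_num)
  have h2 := hn.inner_neg_of_mem_interior h1
  have h3 : (1 / 2 : ℝ) • y + (1 / 2 : ℝ) • p - p = (1 / 2 : ℝ) • (y - p) := by module
  rw [h3, real_inner_smul_right] at h2
  linarith

/-- Near `p` the level set of `f` lies in `K`, so `⟪n, ·⟫` has a local maximum on it at `p`, and the
multiplier rule applies. -/
theorem _root_.exists_smul_eq_of_isOuterNormal {K : Set E3} {f : E3 → ℝ} {p n g : E3}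
    (hf : HasStrictFDerivAt f (innerSL ℝ g) p) (hg : g ≠ 0)
    (hK : ∀ᶠ q in 𝓝 p, f q = f p → q ∈ K) (hn : IsOuterNormal K p n) : ∃ c : ℝ, n = c • g := by
  have hext : IsLocalExtrOn (fun y => ⟪n, y⟫) {y | f y = f p} p := by
    right
    have : ∀ᶠ q in 𝓝[{y | f y = f p}] p, ⟪n, q⟫ ≤ ⟪n, p⟫ := by
      rw [eventually_nhdsWithin_iff]
      filter_upwards [hK] with q hq hq'
      have := hn.2 q (hq hq')
      rw [inner_sub_right] at this
      linarith
    exact this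
  have hφ : HasStrictFDerivAt (fun y => ⟪n, y⟫) (innerSL ℝ n) p := (innerSL ℝ n).hasStrictFDerivAt
  obtain ⟨a, b, hab, h⟩ := hext.exists_multipliers_of_hasStrictFDerivAt_1d hf hφ
  have h' : a • g + b • n = 0 := by
    refine ext_inner_right ℝ fun y => ?_
    have := congrArg (fun L : StrongDual ℝ E3 => L y) h
    simpa [inner_add_left, real_inner_smul_left] using this
  have hb : b ≠ 0 := by
    rintro rfl
    have ha : a ≠ 0 := by rintro rfl; exact hab rfl
    simp [ha, hg] at h'
  refine ⟨-(b⁻¹ * a), ?_⟩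
  have h3 : b⁻¹ • (a • g + b • n) = 0 := by rw [h', smul_zero]
  rw [smul_add, smul_smul, smul_smul, inv_mul_cancel₀ hb, one_smul] at h3
  rw [neg_smul]
  exact eq_neg_of_add_eq_zero_right h3

/-- The normalized gradient is the normal up to sign. An interior point `o` fixes the sign, since
outer normals pair positively with `q - o`, and `U` is shrunk to where it persists. -/
theorem exists_isNormalChart (hM : IsC2StrictlyConvexClosedSurface M) {p : E3} (hp : p ∈ M) :
    ∃ U f ν, p ∈ U ∧ IsNormalChart M U f ν := by
  obtain ⟨o, ho⟩ := hM.interior_nonempty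
  obtain ⟨V, f, hV, hpV, hfc, hf0, hMV⟩ := hM.isC2Surface p hp
  have hmem : ∀ q ∈ V, q ∈ M ↔ f q = 0 := fun q hq => by
    have := Set.ext_iff.1 hMV q
    simpa [hq] using this
  have hG : ∀ q ∈ V, ContDiffAt ℝ 1 (gradient f) q := by
    intro q hq
    have h1 : ContDiffAt ℝ 1 (fderiv ℝ f) q :=
      (hfc.contDiffAt (hV.mem_nhds hq)).fderiv_right (m := 1) (by norm_num)
    exact ((InnerProductSpace.toDual ℝ E3).symm.contDiff.contDiffAt).comp q h1
  have hS : ∀ q ∈ V, HasStrictFDerivAt f (innerSL ℝ (gradient f q)) q := by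
    intro q hq
    have h1 := (hfc.contDiffAt (hV.mem_nhds hq)).hasStrictFDerivAt (by norm_num)
    have e : innerSL ℝ (gradient f q) = fderiv ℝ f q := toDual_gradient (𝕜 := ℝ)
    rwa [e]
  have hg0 : ∀ q ∈ V, gradient f q ≠ 0 := by
    intro q hq h
    apply hf0 q hq
    rw [← toDual_gradient (𝕜 := ℝ) (f := f) (x := q), h, map_zero]
  have hcol : ∀ q ∈ V, q ∈ M → ∀ n, IsOuterNormal (convexBody M) q n →
      ∃ c : ℝ, n = c • gradient f q := by
    intro q hq hqM n hn
    refine exists_smul_eq_of_isOuterNormal (hS q hq) (hg0 q hq) ?_ hn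
    filter_upwards [hV.mem_nhds hq] with y hy hy'
    apply subset_convexBody M
    rw [hmem y hy, hy', (hmem q hq).1 hqM]
  have hs0 : ⟪gradient f p, p - o⟫ ≠ 0 := by
    obtain ⟨n, hn⟩ := hM.exists_isOuterNormal hp
    obtain ⟨c, hc⟩ := hcol p hpV hp n hn
    have h1 := hn.inner_neg_of_mem_interior ho
    rw [hc, real_inner_smul_left, ← neg_sub p o, inner_neg_right] at h1
    intro h0
    rw [h0] at h1
    simp at h1
  set s : ℝ := ((SignType.sign ⟪gradient f p, p - o⟫ : SignType) : ℝ) with hs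
  have hspos : 0 < s * ⟪gradient f p, p - o⟫ := by
    rw [hs, _root_.sign_mul_self]; exact abs_pos.2 hs0
  have hsabs : |s| = 1 := by
    rcases lt_or_gt_of_ne hs0 with h | h
    · rw [hs, sign_neg h]; simp
    · rw [hs, sign_pos h]; simp
  have hcont : ContinuousOn (fun q => s * ⟪gradient f q, q - o⟫) V := by
    intro q hq
    have := (hG q hq).continuousAt
    exact (continuousAt_const.mul (ContinuousAt.inner (𝕜 := ℝ) this (by fun_prop))).continuousWithinAt
  have hU := hcont.isOpen_inter_preimage hV isOpen_Ioi (t := Ioi 0)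
  refine ⟨V ∩ (fun q => s * ⟪gradient f q, q - o⟫) ⁻¹' Ioi 0, f,
    fun q => (s * ‖gradient f q‖⁻¹) • gradient f q, ⟨hpV, hspos⟩, hU, ?_, ?_, ?_, ?_, ?_⟩
  · rintro q ⟨hq, -⟩
    have h1 := hG q hq
    exact (contDiffAt_const.mul ((h1.norm ℝ (hg0 q hq)).inv
      (norm_ne_zero_iff.2 (hg0 q hq)))).smul h1
  · rintro q ⟨hq, -⟩
    have := norm_ne_zero_iff.2 (hg0 q hq)
    rw [norm_smul, norm_mul, norm_inv, norm_norm, Real.norm_eq_abs, hsabs]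
    field_simp
  · rintro q ⟨hq, -⟩
    have h0 := norm_ne_zero_iff.2 (hg0 q hq)
    have hs1 : s ≠ 0 := by intro h; simp [h] at hsabs
    refine ⟨s⁻¹ * ‖gradient f q‖, mul_ne_zero (inv_ne_zero hs1) h0, ?_⟩
    convert hS q hq using 1
    rw [map_smul, smul_smul]
    have : s⁻¹ * ‖gradient f q‖ * (s * ‖gradient f q‖⁻¹) = 1 := by field_simp
    rw [this, one_smul]
  · rintro q ⟨hq, -⟩
    exact hmem q hq
  · rintro q ⟨hq, hq2⟩ hqM n hn
    obtain ⟨c, rfl⟩ := hcol q hq hqM n hn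
    have h0 := norm_pos_iff.2 (hg0 q hq)
    have h1 := hn.inner_neg_of_mem_interior ho
    rw [real_inner_smul_left, ← neg_sub q o, inner_neg_right] at h1
    have h2 : 0 < s * ⟪gradient f q, q - o⟫ := hq2
    have h3 : |c| * ‖gradient f q‖ = 1 := by
      have := hn.1
      rwa [norm_smul, Real.norm_eq_abs] at this
    have h4 : c = s * ‖gradient f q‖⁻¹ := by
      have h5 : c = s * |c| := by
        have h6 : 0 < c * ⟪gradient f q, q - o⟫ := by linarith
        rcases abs_eq (zero_le_one) |>.1 hsabs with hs' | hs' <;> rw [hs'] at h2 ⊢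
        · have : 0 < ⟪gradient f q, q - o⟫ := by linarith
          rw [one_mul, abs_of_pos (pos_of_mul_pos_left h6 this.le)]
        · have : ⟪gradient f q, q - o⟫ < 0 := by linarith
          have : c < 0 := by
            by_contra! hc
            nlinarith
          rw [abs_of_neg this]; ring
      rw [h5]
      congr 1
      field_simp
      exact h3
    rw [h4]

theorem isOuterNormal_unique (hM : IsC2StrictlyConvexClosedSurface M) {p n n' : E3} (hp : p ∈ M)
    (hn : IsOuterNormal (convexBody M) p n) (hn' : IsOuterNormal (convexBody M) p n') : n = n' := by
  obtain ⟨U, f, ν, hU, hch⟩ := hM.exists_isNormalChart hp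
  rw [hch.eq_of_isOuterNormal p hU hp n hn, hch.eq_of_isOuterNormal p hU hp n' hn']

/-- Otherwise a plane separates the line from the interior; it is parallel to `d` and its normal
supports the body at `p`, so uniqueness of the normal gives `⟪n, d⟫ = 0`. -/
theorem exists_add_smul_mem_interior (hM : IsC2StrictlyConvexClosedSurface M) {p n d : E3}
    (hp : p ∈ M) (hn : IsOuterNormal (convexBody M) p n) (hd : ⟪n, d⟫ ≠ 0) :
    ∃ t : ℝ, p + t • d ∈ interior (convexBody M) := by
  by_contra! h
  have hline : Convex ℝ (Set.range fun t : ℝ => p + t • d) := by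
    rintro _ ⟨s, rfl⟩ _ ⟨t, rfl⟩ a b _ _ hab
    refine ⟨a * s + b * t, ?_⟩
    have : a • (p + s • d) + b • (p + t • d) = (a + b) • p + (a * s + b * t) • d := by module
    rw [this, hab, one_smul]
  obtain ⟨f, u, hlt, hge⟩ := geometric_hahn_banach_open (convex_convexBody M).interior
    isOpen_interior hline (by
      rw [Set.disjoint_left]
      rintro _ hy ⟨t, rfl⟩
      exact h t hy)
  have hge' : ∀ t : ℝ, u ≤ f p + t * f d := fun t => by simpa using hge _ ⟨t, rfl⟩
  -- An affine function bounded below on a whole line is constant on it.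
  have hfd : f d = 0 := by
    by_contra h0
    have := hge' ((u - f p - 1) / f d)
    rw [div_mul_cancel₀ _ h0] at this
    linarith
  have hfp := hge' 0
  set v := (InnerProductSpace.toDual ℝ E3).symm f with hv
  have hfv : ∀ y, ⟪v, y⟫ = f y := fun y => by simp [hv]
  obtain ⟨hv0, hvn⟩ := hM.isOuterNormal_of_forall_lt (v := v) (p := p) fun y hy => by
    rw [hfv, hfv]
    have := hlt y hy
    linarith
  apply hd
  rw [hM.isOuterNormal_unique hp hn hvn, real_inner_smul_left, hfv, hfd, mul_zero]

end IsC2StrictlyConvexClosedSurface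

/-! ### Principal directions and umbilics. -/

/-- The vector `u` is a principal direction at `p` for the unit normal field `ν`. -/
def IsPrincipalDirection (ν : E3 → E3) (p u : E3) : Prop :=
  ∀ w, ⟪ν p, w⟫ = 0 → ⟪w, u⟫ = 0 → ⟪fderiv ℝ ν p w, u⟫ = 0

/-- All the tangent directions at `p` are principal for the unit normal field `ν`. -/
def IsUmbilic (ν : E3 → E3) (p : E3) : Prop :=
  ∀ u, ⟪ν p, u⟫ = 0 → IsPrincipalDirection ν p u

theorem IsPrincipalDirection.of_smul {ν : E3 → E3} {p u : E3} {k : ℝ} (hk : k ≠ 0)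
    (h : IsPrincipalDirection ν p (k • u)) : IsPrincipalDirection ν p u := by
  intro w hw hwu
  have := h w hw (by rw [real_inner_smul_right, hwu, mul_zero])
  rw [real_inner_smul_right] at this
  exact (mul_eq_zero.1 this).resolve_left hk

/-- The curve comes from the implicit function theorem, moving along `v` in the kernel of the
differential. -/
theorem IsNormalChart.isTangentVector {M U : Set E3} {f : E3 → ℝ} {ν : E3 → E3}
    (h : IsNormalChart M U f ν) {q v : E3} (hqU : q ∈ U) (hq : q ∈ M) (hv : ⟪ν q, v⟫ = 0) :
    IsTangentVector M q v := by
  obtain ⟨c, hc, hf⟩ := h.hasStrictFDerivAt q hqU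
  set f' : StrongDual ℝ E3 := c • innerSL ℝ (ν q) with hf'
  have hr : f'.range = ⊤ := by
    refine LinearMap.range_eq_top.2 fun y => ⟨(c⁻¹ * y) • ν q, ?_⟩
    simp [hf', h.norm_eq_one q hqU]
    field_simp
  have hvk : v ∈ f'.ker := by simp [hf', hv]
  set g : f'.ker → E3 := hf.implicitFunction f f' hr (f q) with hg
  have hgd : HasFDerivAt g f'.ker.subtypeL 0 := (hf.to_implicitFunction hr).hasFDerivAt
  have hg0 : g 0 = q := by
    exact hf.implicitFunction_apply_image hr
  have hl : HasDerivAt (fun t : ℝ => t • (⟨v, hvk⟩ : f'.ker)) ⟨v, hvk⟩ 0 := by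
    simpa using (hasDerivAt_id (0 : ℝ)).smul_const (⟨v, hvk⟩ : f'.ker)
  have hcd : HasDerivAt (fun t : ℝ => g (t • (⟨v, hvk⟩ : f'.ker))) v 0 := by
    have := HasFDerivAt.comp_hasDerivAt (f := fun t : ℝ => t • (⟨v, hvk⟩ : f'.ker)) (0 : ℝ)
      (l := g) (l' := f'.ker.subtypeL) (by simpa using hgd) hl
    exact this
  refine ⟨fun t => g (t • ⟨v, hvk⟩), by simp [hg0], ?_, hcd⟩
  have hU : ∀ᶠ t in 𝓝 (0 : ℝ), g (t • ⟨v, hvk⟩) ∈ U := by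
    apply hcd.continuousAt.eventually_mem
    simpa [hg0] using h.isOpen.mem_nhds hqU
  have hz : ∀ᶠ t in 𝓝 (0 : ℝ), f (g (t • ⟨v, hvk⟩)) = f q := by
    have h1 := hf.map_implicitFunction_eq hr
    have h2 : Tendsto (fun t : ℝ => (f q, t • (⟨v, hvk⟩ : f'.ker))) (𝓝 0) (𝓝 (f q, 0)) := by
      refine tendsto_const_nhds.prodMk_nhds ?_
      have := hl.continuousAt.tendsto
      simpa using this
    exact h2.eventually h1
  filter_upwards [hU, hz] with t h1 h2
  rw [h.mem_iff _ h1, h2, ← h.mem_iff q hqU]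
  exact hq

/-- The curvature may degenerate, so the contact set need not be a smooth curve at `p`; the
multiplier rule that allows a zero coefficient on the objective copes with this. -/
theorem IsNormalChart.isPrincipalDirection {M U : Set E3} {f : E3 → ℝ} {ν : E3 → E3}
    (h : IsNormalChart M U f ν) {p x : E3} (hpU : p ∈ U) (hp : p ∈ M) (hx : x ∈ equitangentSet M)
    (hpx : ⟪ν p, p - x⟫ = 0) : IsPrincipalDirection ν p (p - x) := by
  have hcont : ∀ q ∈ U, q ∈ M → ⟪ν q, q - x⟫ = 0 → q ∈ contactSet M x := fun q hqU hq hqx =>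
    ⟨hq, h.isTangentVector hqU hq hqx⟩
  have hne : p - x ≠ 0 := by
    intro h0
    rw [sub_eq_zero] at h0
    exact hx.1 (h0 ▸ subset_convexBody M hp)
  obtain ⟨c, hc, hf⟩ := h.hasStrictFDerivAt p hpU
  have hν : HasStrictFDerivAt ν (fderiv ℝ ν p) p :=
    (h.contDiffAt p hpU).hasStrictFDerivAt (by norm_num)
  set A := fderiv ℝ ν p
  have hid : HasStrictFDerivAt (fun q : E3 => q - x) (ContinuousLinearMap.id ℝ E3) p :=
    (hasStrictFDerivAt_id p).sub_const x
  have hF := hν.inner ℝ hid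
  have hφ := hid.inner ℝ hid
  set F := ![f, fun q => ⟪ν q, q - x⟫] with hFdef
  have hext : IsLocalExtrOn (fun q => ⟪q - x, q - x⟫) {q | ∀ i, F i q = F i p} p := by
    left
    have : ∀ᶠ q in 𝓝[{q | ∀ i, F i q = F i p}] p, ⟪p - x, p - x⟫ ≤ ⟪q - x, q - x⟫ := by
      rw [eventually_nhdsWithin_iff]
      filter_upwards [h.isOpen.mem_nhds hpU] with q hqU hq
      have h0 : f q = f p := hq 0
      have h1 : ⟪ν q, q - x⟫ = ⟪ν p, p - x⟫ := hq 1
      have hqM : q ∈ M := by rw [h.mem_iff q hqU, h0, ← h.mem_iff p hpU]; exact hp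
      have := hx.2 q (hcont q hqU hqM (h1.trans hpx)) p (hcont p hpU hp hpx)
      rw [dist_comm, dist_eq_norm, dist_comm, dist_eq_norm] at this
      rw [real_inner_self_eq_norm_sq, real_inner_self_eq_norm_sq, this]
    exact this
  obtain ⟨Λ, Λ₀, hΛ, hsum⟩ := hext.exists_multipliers_of_hasStrictFDerivAt
    (f' := ![c • innerSL ℝ (ν p), _]) (fun i => by
      fin_cases i
      · exact hf
      · exact hF) hφ
  have hs : ∀ w, Λ 0 * (c * ⟪ν p, w⟫) + Λ 1 * (⟪ν p, w⟫ + ⟪A w, p - x⟫) +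
      Λ₀ * (2 * ⟪p - x, w⟫) = 0 := by
    intro w
    have := congrArg (fun L : StrongDual ℝ E3 => L w) hsum
    simp [Fin.sum_univ_two] at this
    rw [real_inner_comm (p - x) w] at this
    linarith
  -- If `Λ 1 = 0`, the remaining gradients are along `ν p` and `p - x`, nonzero and orthogonal, so
  -- all multipliers vanish.
  have hΛ1 : Λ 1 ≠ 0 := by
    intro h1
    have e1 := hs (p - x)
    rw [hpx, h1, real_inner_self_eq_norm_sq] at e1
    have h2 : Λ₀ = 0 := by
      have := norm_ne_zero_iff.2 hne
      have e2 : Λ₀ * (2 * ‖p - x‖ ^ 2) = 0 := by linarith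
      exact (mul_eq_zero.1 e2).resolve_right (by positivity)
    have e3 := hs (ν p)
    rw [h1, h2, real_inner_self_eq_norm_sq, h.norm_eq_one p hpU] at e3
    have h0 : Λ 0 = 0 := by
      have e4 : Λ 0 * c = 0 := by linarith
      exact (mul_eq_zero.1 e4).resolve_right hc
    apply hΛ
    rw [Prod.mk_eq_zero]
    refine ⟨funext fun i => ?_, h2⟩
    fin_cases i
    · exact h0
    · exact h1
  intro w hw hwu
  have e := hs w
  rw [hw, real_inner_comm w (p - x), hwu] at e
  have e' : Λ 1 * ⟪A w, p - x⟫ = 0 := by linarith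
  exact (mul_eq_zero.1 e').resolve_left hΛ1

theorem eq_inner_smul_add_inner_smul {n v w u : E3} (hn : ‖n‖ = 1) (hv : ‖v‖ = 1) (hw : ‖w‖ = 1)
    (hnv : ⟪n, v⟫ = 0) (hnw : ⟪n, w⟫ = 0) (hvw : ⟪v, w⟫ = 0) (hu : ⟪n, u⟫ = 0) :
    u = ⟪v, u⟫ • v + ⟪w, u⟫ • w := by
  have ho : Orthonormal ℝ ![n, v, w] := by
    refine ⟨fun i => ?_, fun i j hij => ?_⟩
    · fin_cases i <;> simp [hn, hv, hw]
    · fin_cases i <;> fin_cases j <;>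
        simp_all [real_inner_comm]
  let b := basisOfOrthonormalOfCardEqFinrank ho (by simp)
  have hb : ⇑b = ![n, v, w] := coe_basisOfOrthonormalOfCardEqFinrank ho (by simp)
  let b' := b.toOrthonormalBasis (by rw [hb]; exact ho)
  have := b'.sum_repr' u
  simp only [b', Module.Basis.coe_toOrthonormalBasis, hb, Fin.sum_univ_three] at this
  simp [hu] at this
  exact this.symm

/-- The identity multiplies `c` by the homogeneous Vandermonde determinant of the three zeros. -/
theorem eq_zero_of_quadratic_form_three_zeros {a b c s₁ t₁ s₂ t₂ s₃ t₃ : ℝ}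
    (h₁ : a * s₁ ^ 2 + b * (s₁ * t₁) + c * t₁ ^ 2 = 0)
    (h₂ : a * s₂ ^ 2 + b * (s₂ * t₂) + c * t₂ ^ 2 = 0)
    (h₃ : a * s₃ ^ 2 + b * (s₃ * t₃) + c * t₃ ^ 2 = 0)
    (h₁₂ : s₁ * t₂ - s₂ * t₁ ≠ 0) (h₁₃ : s₁ * t₃ - s₃ * t₁ ≠ 0) (h₂₃ : s₂ * t₃ - s₃ * t₂ ≠ 0) :
    c = 0 := by
  have : c * ((s₁ * t₂ - s₂ * t₁) * (s₁ * t₃ - s₃ * t₁) * (s₂ * t₃ - s₃ * t₂)) = 0 := by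
    linear_combination (s₂ * s₃ * (s₂ * t₃ - s₃ * t₂)) * h₁ -
      (s₁ * s₃ * (s₁ * t₃ - s₃ * t₁)) * h₂ + (s₁ * s₂ * (s₁ * t₂ - s₂ * t₁)) * h₃
  exact (mul_eq_zero.1 this).resolve_right (by positivity)

/-- In an orthonormal tangent basis `v, w`, being principal is the vanishing of a quadratic form in
the coordinates of `u`, with `⟪fderiv ℝ ν p v, w⟫` as a coefficient. Three independent zeros kill
it, without using symmetry of the differential. -/
theorem isUmbilic_of_three_directions {ν : E3 → E3} {p u₁ u₂ u₃ : E3} (hν : ‖ν p‖ = 1)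
    (h₁ : ⟪ν p, u₁⟫ = 0) (h₂ : ⟪ν p, u₂⟫ = 0) (h₃ : ⟪ν p, u₃⟫ = 0)
    (hp₁ : IsPrincipalDirection ν p u₁) (hp₂ : IsPrincipalDirection ν p u₂)
    (hp₃ : IsPrincipalDirection ν p u₃) (h₁₂ : LinearIndependent ℝ ![u₁, u₂])
    (h₁₃ : LinearIndependent ℝ ![u₁, u₃]) (h₂₃ : LinearIndependent ℝ ![u₂, u₃]) :
    IsUmbilic ν p := by
  have key : ∀ v w : E3, ‖v‖ = 1 → ‖w‖ = 1 → ⟪ν p, v⟫ = 0 → ⟪ν p, w⟫ = 0 → ⟪v, w⟫ = 0 →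
      ⟪fderiv ℝ ν p v, w⟫ = 0 := by
    intro v w hv hw hnv hnw hvw
    have hdec : ∀ u, ⟪ν p, u⟫ = 0 → u = ⟪v, u⟫ • v + ⟪w, u⟫ • w := fun u hu =>
      eq_inner_smul_add_inner_smul hν hv hw hnv hnw hvw hu
    have hq : ∀ u, ⟪ν p, u⟫ = 0 → IsPrincipalDirection ν p u →
        (-⟪fderiv ℝ ν p w, v⟫) * ⟪v, u⟫ ^ 2 +
        (⟪fderiv ℝ ν p v, v⟫ - ⟪fderiv ℝ ν p w, w⟫) * (⟪v, u⟫ * ⟪w, u⟫) +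
        ⟪fderiv ℝ ν p v, w⟫ * ⟪w, u⟫ ^ 2 = 0 := by
      intro u hu hpu
      -- The test vector is `u` turned by a right angle in the tangent plane.
      have e := hpu (⟪w, u⟫ • v - ⟪v, u⟫ • w)
        (by rw [inner_sub_right, real_inner_smul_right, real_inner_smul_right, hnv, hnw]; ring)
        (by rw [inner_sub_left, real_inner_smul_left, real_inner_smul_left]; ring)
      generalize hs : ⟪v, u⟫ = s at *
      generalize ht : ⟪w, u⟫ = t at *
      have hu' := hdec u hu
      rw [hs, ht] at hu'
      rw [hu'] at e
      simp only [map_sub, map_smul, inner_sub_left, inner_add_right, real_inner_smul_left,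
        real_inner_smul_right] at e
      linarith
    have hind : ∀ u u', ⟪ν p, u⟫ = 0 → ⟪ν p, u'⟫ = 0 → LinearIndependent ℝ ![u, u'] →
        ⟪v, u⟫ * ⟪w, u'⟫ - ⟪v, u'⟫ * ⟪w, u⟫ ≠ 0 := by
      intro u u' hu hu' hli h0
      rw [LinearIndependent.pair_iff] at hli
      have e := hdec u hu
      have e' := hdec u' hu'
      generalize ⟪v, u⟫ = s at *
      generalize ⟪w, u⟫ = t at *
      generalize ⟪v, u'⟫ = s' at *
      generalize ⟪w, u'⟫ = t' at *
      have a1 := hli t' (-t) (by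
        rw [e, e']
        have : t' • (s • v + t • w) + -t • (s' • v + t' • w) = (s * t' - s' * t) • v := by module
        rw [this, h0, zero_smul])
      have a2 := hli s' (-s) (by
        rw [e, e']
        have : s' • (s • v + t • w) + -s • (s' • v + t' • w) = (-(s * t' - s' * t)) • w := by
          module
        rw [this, h0, neg_zero, zero_smul])
      have : u = 0 := by
        rw [e, neg_eq_zero.1 a1.2, neg_eq_zero.1 a2.2]; simp
      have := hli 1 0 (by simp [this])
      exact one_ne_zero this.1
    exact eq_zero_of_quadratic_form_three_zeros (hq u₁ h₁ hp₁) (hq u₂ h₂ hp₂) (hq u₃ h₃ hp₃)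
      (hind u₁ u₂ h₁ h₂ h₁₂) (hind u₁ u₃ h₁ h₃ h₁₃) (hind u₂ u₃ h₂ h₃ h₂₃)
  intro u hu w hw hwu
  rcases eq_or_ne u 0 with rfl | hu0
  · simp
  rcases eq_or_ne w 0 with rfl | hw0
  · simp
  have := key (‖w‖⁻¹ • w) (‖u‖⁻¹ • u) (norm_smul_inv_norm hw0) (norm_smul_inv_norm hu0)
    (by rw [real_inner_smul_right, hw, mul_zero]) (by rw [real_inner_smul_right, hu, mul_zero])
    (by rw [real_inner_smul_right, real_inner_smul_left, hwu, mul_zero, mul_zero])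
  rw [map_smul, real_inner_smul_right, real_inner_smul_left] at this
  have h1 := norm_ne_zero_iff.2 hu0
  have h2 := norm_ne_zero_iff.2 hw0
  simpa [h1, h2, hu0, hw0] using this

theorem IsNormalChart.isUmbilic_of_mem_closure {M U : Set E3} {f : E3 → ℝ} {ν : E3 → E3}
    (h : IsNormalChart M U f ν) {p : E3} (hpU : p ∈ U)
    (hp : p ∈ closure {q ∈ U | IsUmbilic ν q}) : IsUmbilic ν p := by
  intro u hu w hw hwu
  rcases eq_or_ne u 0 with rfl | hu0
  · simp
  have hν : ContinuousAt ν p := (h.contDiffAt p hpU).continuousAt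
  have hA : ContinuousAt (fderiv ℝ ν) p :=
    ((h.contDiffAt p hpU).fderiv_right (m := 0) (by norm_num)).continuousAt
  -- The tangent plane varies with `q`: `u` and `w` are projected onto it, then `w'` is made
  -- orthogonal to `u'` without division.
  set u' : E3 → E3 := fun q => u - ⟪ν q, u⟫ • ν q with hu'
  set w' : E3 → E3 := fun q => w - ⟪ν q, w⟫ • ν q with hw'
  set w'' : E3 → E3 := fun q => ⟪u' q, u' q⟫ • w' q - ⟪w' q, u' q⟫ • u' q with hw''
  have cu : ContinuousAt u' p :=
    continuousAt_const.sub ((hν.inner (𝕜 := ℝ) continuousAt_const).smul hν)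
  have cw : ContinuousAt w' p :=
    continuousAt_const.sub ((hν.inner (𝕜 := ℝ) continuousAt_const).smul hν)
  have cw' : ContinuousAt w'' p :=
    ((cu.inner (𝕜 := ℝ) cu).smul cw).sub ((cw.inner (𝕜 := ℝ) cu).smul cu)
  have cΦ : ContinuousAt (fun q => ⟪fderiv ℝ ν q (w'' q), u' q⟫) p :=
    (hA.clm_apply cw').inner (𝕜 := ℝ) cu
  have e0 : ⟪fderiv ℝ ν p (w'' p), u' p⟫ = 0 := by
    by_contra hne
    obtain ⟨q, hq1, hqU, hq2⟩ := mem_closure_iff_nhds.1 hp _ (cΦ.eventually_ne hne)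
    have hq3 := h.norm_eq_one q hqU
    have ho : ∀ z, ⟪ν q, z - ⟪ν q, z⟫ • ν q⟫ = 0 := fun z => by
      rw [inner_sub_right, real_inner_smul_right, real_inner_self_eq_norm_sq, hq3]; ring
    refine hq1 (hq2 (u' q) (ho u) (w'' q) ?_ ?_)
    · simp only [hw'', inner_sub_right, real_inner_smul_right]
      have a1 : ⟪ν q, w' q⟫ = 0 := ho w
      have a2 : ⟪ν q, u' q⟫ = 0 := ho u
      rw [a1, a2]; ring
    · simp only [hw'', inner_sub_left, real_inner_smul_left]
      ring
  have e1 : u' p = u := by simp [hu', hu]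
  have e2 : w' p = w := by simp [hw', hw]
  have e3 : w'' p = (‖u‖ ^ 2) • w := by simp [hw'', e1, e2, hwu]
  rw [e3, e1, map_smul, real_inner_smul_left] at e0
  exact (mul_eq_zero.1 e0).resolve_left (by have := norm_ne_zero_iff.2 hu0; positivity)

/-! ### Radial projection onto the surface and its differentiability. -/

/-- The gauge of the convex body bounded by `M`, with respect to the origin `o`. -/
noncomputable def bodyGauge (M : Set E3) (o z : E3) : ℝ := gauge {y | o + y ∈ convexBody M} z

/-- The point where the ray issued from `o` in the direction `z` crosses `M`. -/
noncomputable def radialPoint (M : Set E3) (o z : E3) : E3 := o + (bodyGauge M o z)⁻¹ • z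

theorem exists_ne_zero_inner_eq_zero (a b : E3) : ∃ m : E3, m ≠ 0 ∧ ⟪a, m⟫ = 0 ∧ ⟪b, m⟫ = 0 := by
  have h : (Submodule.span ℝ (Set.range ![a, b]))ᗮ ≠ ⊥ := by
    rw [Ne, Submodule.orthogonal_eq_bot_iff]
    intro h
    have h1 := finrank_range_le_card (R := ℝ) (b := ![a, b])
    rw [Set.finrank, h, finrank_top] at h1
    simp at h1
  obtain ⟨m, hm, hm0⟩ := Submodule.exists_mem_ne_zero_of_ne_bot h
  rw [Submodule.mem_orthogonal] at hm
  exact ⟨m, hm0, hm a (Submodule.subset_span ⟨0, rfl⟩), hm b (Submodule.subset_span ⟨1, rfl⟩)⟩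

namespace IsC2StrictlyConvexClosedSurface

variable {M : Set E3}

theorem convex_translate (M : Set E3) (o : E3) : Convex ℝ {y | o + y ∈ convexBody M} :=
  (convex_convexBody M).translate_preimage_right o

theorem translate_mem_nhds {o : E3} (ho : o ∈ interior (convexBody M)) :
    {y | o + y ∈ convexBody M} ∈ 𝓝 (0 : E3) := by
  have : Tendsto (fun y : E3 => o + y) (𝓝 0) (𝓝 o) := by
    have : Continuous (fun y : E3 => o + y) := by fun_prop
    simpa using this.tendsto 0
  exact this (mem_interior_iff_mem_nhds.1 ho)

theorem bodyGauge_eq_one_iff (hM : IsC2StrictlyConvexClosedSurface M) {o : E3}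
    (ho : o ∈ interior (convexBody M)) {z : E3} : bodyGauge M o z = 1 ↔ o + z ∈ M := by
  rw [bodyGauge, gauge_eq_one_iff_mem_frontier (convex_translate M o) (translate_mem_nhds ho)]
  have := (Homeomorph.addLeft o).preimage_frontier (convexBody M)
  rw [← hM.eq_frontier] at this
  exact (Set.ext_iff.1 this z).symm

theorem bodyGauge_pos (hM : IsC2StrictlyConvexClosedSurface M) {o : E3}
    (ho : o ∈ interior (convexBody M)) {z : E3} (hz : z ≠ 0) : 0 < bodyGauge M o z := by
  refine (gauge_pos (absorbent_nhds_zero (translate_mem_nhds ho)) ?_).2 hz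
  rw [NormedSpace.isVonNBounded_iff]
  have h2 : {y | o + y ∈ convexBody M} = (fun y => -o + y) '' convexBody M := by
    ext y
    constructor
    · intro hy
      exact ⟨o + y, hy, by simp⟩
    · rintro ⟨x, hx, rfl⟩
      simpa using hx
  rw [h2]
  exact (hM.isCompact_convexBody.image (by fun_prop)).isBounded

theorem radialPoint_mem (hM : IsC2StrictlyConvexClosedSurface M) {o : E3}
    (ho : o ∈ interior (convexBody M)) {z : E3} (hz : z ≠ 0) : radialPoint M o z ∈ M := by
  rw [radialPoint, ← hM.bodyGauge_eq_one_iff ho]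
  have h := hM.bodyGauge_pos ho hz
  rw [bodyGauge, gauge_smul_of_nonneg (inv_nonneg.2 h.le), smul_eq_mul]
  exact inv_mul_cancel₀ h.ne'

theorem radialPoint_sub (hM : IsC2StrictlyConvexClosedSurface M) {o p : E3}
    (ho : o ∈ interior (convexBody M)) (hp : p ∈ M) : radialPoint M o (p - o) = p := by
  have : bodyGauge M o (p - o) = 1 := (hM.bodyGauge_eq_one_iff ho).2 (by simpa using hp)
  rw [radialPoint, this]
  simp

theorem continuous_bodyGauge {o : E3} (ho : o ∈ interior (convexBody M)) :
    Continuous (bodyGauge M o) :=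
  continuous_gauge (convex_translate M o) (translate_mem_nhds ho)

theorem continuousAt_radialPoint (hM : IsC2StrictlyConvexClosedSurface M) {o : E3}
    (ho : o ∈ interior (convexBody M)) {z : E3} (hz : z ≠ 0) :
    ContinuousAt (radialPoint M o) z :=
  continuousAt_const.add (((continuous_bodyGauge ho).continuousAt.inv₀
    (hM.bodyGauge_pos ho hz).ne').smul continuousAt_id)

theorem radialPoint_isBigO (hM : IsC2StrictlyConvexClosedSurface M) {o : E3}
    (ho : o ∈ interior (convexBody M)) {z₀ : E3} (hz₀ : z₀ ≠ 0) :
    (fun z => radialPoint M o z - radialPoint M o z₀) =O[𝓝 z₀] fun z => z - z₀ := by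
  obtain ⟨C, hC⟩ := (convex_translate M o).lipschitz_gauge (translate_mem_nhds ho)
  have hg : (fun z => bodyGauge M o z₀ - bodyGauge M o z) =O[𝓝 z₀] fun z => z - z₀ := by
    refine Asymptotics.IsBigO.of_bound C (Eventually.of_forall fun z => ?_)
    have := hC.dist_le_mul z₀ z
    rwa [dist_eq_norm, dist_comm, dist_eq_norm] at this
  have h0 := (hM.bodyGauge_pos ho hz₀).ne'
  have hinv : (fun z => (bodyGauge M o z)⁻¹) =O[𝓝 z₀] fun _ => (1 : ℝ) :=
    ((continuous_bodyGauge ho).continuousAt.inv₀ h0).tendsto.isBigO_one ℝ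
  have h1 : (fun z => (bodyGauge M o z)⁻¹ • (z - z₀)) =O[𝓝 z₀] fun z => z - z₀ := by
    simpa using hinv.smul (Asymptotics.isBigO_refl (fun z => z - z₀) (𝓝 z₀))
  have h2 : (fun z => (bodyGauge M o z)⁻¹ • ((bodyGauge M o z₀ - bodyGauge M o z) •
      ((bodyGauge M o z₀)⁻¹ • z₀))) =O[𝓝 z₀] fun z => z - z₀ := by
    have h3 : (fun z => (bodyGauge M o z₀ - bodyGauge M o z) • ((bodyGauge M o z₀)⁻¹ • z₀))
        =O[𝓝 z₀] fun z => z - z₀ := by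
      have := hg.norm_right.smul (Asymptotics.isBigO_const_const ((bodyGauge M o z₀)⁻¹ • z₀)
        (one_ne_zero : (1 : ℝ) ≠ 0) (𝓝 z₀))
      simpa using this
    simpa using hinv.smul h3
  refine (h1.add h2).congr' ?_ EventuallyEq.rfl
  have hne : ∀ᶠ z in 𝓝 z₀, bodyGauge M o z ≠ 0 :=
    (continuous_bodyGauge ho).continuousAt.eventually_ne h0
  filter_upwards [hne] with z hz
  simp only [radialPoint]
  rw [smul_smul, smul_smul, add_sub_add_left_eq_sub, smul_sub, sub_add, ← sub_smul]
  congr 2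
  field_simp
  ring

theorem exists_isOuterNormal_chart (hM : IsC2StrictlyConvexClosedSurface M) {p : E3}
    (hp : p ∈ M) : ∃ U f ν, p ∈ U ∧ IsNormalChart M U f ν ∧
      ∀ q ∈ U, q ∈ M → IsOuterNormal (convexBody M) q (ν q) := by
  obtain ⟨U, f, ν, hpU, h⟩ := hM.exists_isNormalChart hp
  refine ⟨U, f, ν, hpU, h, fun q hq hqM => ?_⟩
  obtain ⟨n, hn⟩ := hM.exists_isOuterNormal hqM
  rwa [← h.eq_of_isOuterNormal q hq hqM n hn]

/-- As `f` vanishes at radial points and these vary in a Lipschitz way, `⟪n, radialPoint M o z -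
y₀⟫` is `o(z - z₀)`. Multiplied by the gauge this reads `⟪n, z⟫ - k * bodyGauge M o z = o(z - z₀)`,
which is differentiability. -/
theorem differentiableAt_bodyGauge (hM : IsC2StrictlyConvexClosedSurface M) {o : E3}
    (ho : o ∈ interior (convexBody M)) {z₀ : E3} (hz₀ : z₀ ≠ 0) :
    DifferentiableAt ℝ (bodyGauge M o) z₀ := by
  set y₀ := radialPoint M o z₀ with hy₀
  have hy₀M : y₀ ∈ M := hM.radialPoint_mem ho hz₀
  obtain ⟨U, f, ν, hU, hch, hnor⟩ := hM.exists_isOuterNormal_chart hy₀M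
  obtain ⟨c, hc, hf⟩ := hch.hasStrictFDerivAt y₀ hU
  have hg₀ := hM.bodyGauge_pos ho hz₀
  have hcont := hM.continuousAt_radialPoint ho hz₀
  have hneg := (hnor y₀ hU hy₀M).inner_neg_of_mem_interior ho
  set n := ν y₀
  have hk : ⟪n, z₀⟫ ≠ 0 := by
    intro h0
    rw [hy₀, radialPoint, sub_add_cancel_left, inner_neg_right, real_inner_smul_right, h0] at hneg
    simp at hneg
  have h1 := (hf.hasFDerivAt.isLittleO.comp_tendsto hcont.tendsto).trans_isBigO
    (hM.radialPoint_isBigO ho hz₀)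
  have h2 : (fun z => ⟪n, radialPoint M o z - y₀⟫) =o[𝓝 z₀] fun z => z - z₀ := by
    have h3 := h1.const_mul_left (-c⁻¹)
    refine h3.congr' ?_ EventuallyEq.rfl
    filter_upwards [hcont.eventually_mem (hch.isOpen.mem_nhds hU),
      isOpen_ne.mem_nhds hz₀] with z hz hz0
    have e1 := (hch.mem_iff _ hz).1 (hM.radialPoint_mem ho hz0)
    have e2 := (hch.mem_iff _ hU).1 hy₀M
    simp only [Function.comp, e1, e2]
    simp
    field_simp
  set k := ⟪n, z₀⟫ / bodyGauge M o z₀ with hkdef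
  have hk0 : k ≠ 0 := div_ne_zero hk hg₀.ne'
  have hgO : (fun z => bodyGauge M o z) =O[𝓝 z₀] fun _ => (1 : ℝ) :=
    (continuous_bodyGauge ho).continuousAt.tendsto.isBigO_one ℝ
  have h4 : (fun z => bodyGauge M o z * ⟪n, radialPoint M o z - y₀⟫) =o[𝓝 z₀]
      fun z => z - z₀ := by
    have := hgO.mul_isLittleO h2.norm_right
    simpa using this
  have h5 := h4.const_mul_left (-k⁻¹)
  have h6 : HasFDerivAt (bodyGauge M o) (k⁻¹ • innerSL ℝ n) z₀ := by
    refine .of_isLittleO (h5.congr' ?_ EventuallyEq.rfl)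
    filter_upwards [isOpen_ne.mem_nhds hz₀] with z hz
    have e1 := (hM.bodyGauge_pos ho hz).ne'
    rw [hy₀, radialPoint, radialPoint, add_sub_add_left_eq_sub, inner_sub_right,
      real_inner_smul_right, real_inner_smul_right]
    simp only [smul_apply, innerSL_apply_apply, smul_eq_mul, inner_sub_right,
      hkdef]
    field_simp
    ring
  exact h6.differentiableAt

theorem differentiableAt_radialPoint (hM : IsC2StrictlyConvexClosedSurface M) {o : E3}
    (ho : o ∈ interior (convexBody M)) {z : E3} (hz : z ≠ 0) :
    DifferentiableAt ℝ (radialPoint M o) z :=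
  (differentiableAt_const o).add (((hM.differentiableAt_bodyGauge ho hz).inv
    (hM.bodyGauge_pos ho hz).ne').smul differentiableAt_id)

/-! ### Umbilic convex surfaces are spheres. -/

/-- The derivative of the normal is orthogonal to the normal part of `e` because `‖ν‖ = 1`, and to
its tangential part by umbilicity, that part being orthogonal to `v` as well. -/
theorem hasDerivAt_inner_normal_zero {n : E3 → E3}
    (hn : ∀ p ∈ M, IsOuterNormal (convexBody M) p (n p)) {U : Set E3} {f : E3 → ℝ} {ν : E3 → E3} (hch : IsNormalChart M U f ν)
    {γ : ℝ → E3} {t : ℝ} {e v : E3} (hγ : HasDerivAt γ v t) (hγM : ∀ s, γ s ∈ M)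
    (hU : γ t ∈ U) (humb : IsUmbilic ν (γ t)) (he : ⟪v, e⟫ = 0) :
    HasDerivAt (fun s => ⟪n (γ s), e⟫) 0 t := by
  have hev : ∀ᶠ s in 𝓝 t, γ s ∈ U := hγ.continuousAt.eventually_mem (hch.isOpen.mem_nhds hU)
  obtain ⟨c, hc, hf⟩ := hch.hasStrictFDerivAt _ hU
  have hνv : ⟪ν (γ t), v⟫ = 0 := by
    have h1 : HasDerivAt (fun s => f (γ s)) _ t := hf.hasFDerivAt.comp_hasDerivAt t hγ
    have h2 : HasDerivAt (fun s => f (γ s)) 0 t := by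
      refine (hasDerivAt_const t (0 : ℝ)).congr_of_eventuallyEq ?_
      filter_upwards [hev] with s hs
      exact (hch.mem_iff _ hs).1 (hγM s)
    have h3 := h1.unique h2
    simpa [hc] using h3
  have hν : HasFDerivAt ν (fderiv ℝ ν (γ t)) (γ t) :=
    ((hch.contDiffAt _ hU).differentiableAt (by norm_num)).hasFDerivAt
  have hd : HasDerivAt (fun s => ν (γ s)) (fderiv ℝ ν (γ t) v) t := hν.comp_hasDerivAt t hγ
  have hn1 : ⟪fderiv ℝ ν (γ t) v, ν (γ t)⟫ = 0 := by
    have h1 := hd.inner ℝ hd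
    have h2 : HasDerivAt (fun s => ⟪ν (γ s), ν (γ s)⟫) 0 t := by
      refine (hasDerivAt_const t (1 : ℝ)).congr_of_eventuallyEq ?_
      filter_upwards [hev] with s hs
      rw [real_inner_self_eq_norm_sq, hch.norm_eq_one _ hs]
      norm_num
    have h3 := h1.unique h2
    rw [real_inner_comm (fderiv ℝ ν (γ t) v) (ν (γ t))] at h3
    linarith
  have hnn : ⟪ν (γ t), ν (γ t)⟫ = 1 := by
    rw [real_inner_self_eq_norm_sq, hch.norm_eq_one _ hU]; norm_num
  have h0 := humb (e - ⟪ν (γ t), e⟫ • ν (γ t))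
    (by rw [inner_sub_right, real_inner_smul_right, hnn]; ring) v hνv
    (by rw [inner_sub_right, real_inner_smul_right, he,
      real_inner_comm (ν (γ t)) v, hνv]; ring)
  rw [inner_sub_right, real_inner_smul_right, hn1, mul_zero, sub_zero] at h0
  have h5 := hd.inner ℝ (hasDerivAt_const t e)
  rw [inner_zero_right, zero_add, h0] at h5
  refine h5.congr_of_eventuallyEq ?_
  filter_upwards [hev] with s hs
  rw [hch.eq_of_isOuterNormal _ hs (hγM s) _ (hn _ (hγM s))]

theorem inner_normal_sub_eq_zero (hM : IsC2StrictlyConvexClosedSurface M)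
    (humb : ∀ U f ν, IsNormalChart M U f ν → ∀ p ∈ U, p ∈ M → IsUmbilic ν p)
    {n : E3 → E3} (hn : ∀ p ∈ M, IsOuterNormal (convexBody M) p (n p)) {p q e : E3}
    (hp : p ∈ M) (hq : q ∈ M) (he : ⟪p - q, e⟫ = 0) : ⟪n p - n q, e⟫ = 0 := by
  rcases eq_or_ne p q with rfl | hpq
  · simp
  set o : E3 := (1 / 2 : ℝ) • p + (1 / 2 : ℝ) • q with hodef
  have ho : o ∈ interior (convexBody M) :=
    hM.strictConvex (subset_convexBody M hp) (subset_convexBody M hq) hpq (by norm_num)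
      (by norm_num) (by norm_num)
  set a : E3 := (1 / 2 : ℝ) • (p - q) with ha
  have ha0 : a ≠ 0 := smul_ne_zero (by norm_num) (sub_ne_zero.2 hpq)
  have hpo : p - o = a := by rw [hodef, ha]; module
  have hqo : q - o = -a := by rw [hodef, ha]; module
  have hae : ⟪a, e⟫ = 0 := by rw [ha, real_inner_smul_left, he, mul_zero]
  obtain ⟨b, hb0, hab, heb⟩ := exists_ne_zero_inner_eq_zero a e
  -- This arc runs from `-a` to `a` orthogonally to `e`; the term in `b` keeps it away from the
  -- origin, so its radial projection joins `q` to `p` on `M`.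
  set z : ℝ → E3 := fun t => t • a + (1 - t ^ 2) • b with hz
  have hz0 : ∀ t, z t ≠ 0 := by
    intro t h0
    have h1 : ⟪a, z t⟫ = 0 := by rw [h0, inner_zero_right]
    have h2 : ⟪b, z t⟫ = 0 := by rw [h0, inner_zero_right]
    simp only [hz, inner_add_right, real_inner_smul_right, hab, real_inner_comm a b,
      real_inner_self_eq_norm_sq, mul_zero, add_zero, zero_add] at h1 h2
    have h3 : t = 0 := (mul_eq_zero.1 h1).resolve_right (pow_ne_zero 2 (norm_ne_zero_iff.2 ha0))
    rw [h3] at h2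
    simp [hb0] at h2
  have hze : ∀ t, ⟪z t, e⟫ = 0 := by
    intro t
    simp only [hz, inner_add_left, real_inner_smul_left, hae, real_inner_comm e b, heb]
    ring
  set γ : ℝ → E3 := fun t => radialPoint M o (z t) with hγ
  have hγM : ∀ t, γ t ∈ M := fun t => hM.radialPoint_mem ho (hz0 t)
  have hγd : ∀ t, DifferentiableAt ℝ γ t := by
    intro t
    refine (hM.differentiableAt_radialPoint ho (hz0 t)).comp t ?_
    fun_prop
  have hve : ∀ t, ⟪deriv γ t, e⟫ = 0 := by
    intro t
    have h1 := (hγd t).hasDerivAt.inner ℝ (hasDerivAt_const t e)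
    have h2 : HasDerivAt (fun s => ⟪γ s, e⟫) 0 t := by
      have : (fun s => ⟪γ s, e⟫) = fun _ => ⟪o, e⟫ := by
        funext s
        simp only [hγ, radialPoint, inner_add_left, real_inner_smul_left, hze]
        ring
      rw [this]
      exact hasDerivAt_const t _
    have h3 := h1.unique h2
    simpa using h3
  have hder : ∀ t, HasDerivAt (fun s => ⟪n (γ s), e⟫) 0 t := by
    intro t
    obtain ⟨U, f, ν, hU, hch⟩ := hM.exists_isNormalChart (hγM t)
    exact hasDerivAt_inner_normal_zero hn hch (hγd t).hasDerivAt hγM hU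
      (humb U f ν hch _ hU (hγM t)) (hve t)
  have hconst := is_const_of_deriv_eq_zero (fun t => (hder t).differentiableAt)
    (fun t => (hder t).deriv) 1 (-1)
  have e1 : γ 1 = p := by
    have : z 1 = p - o := by rw [hpo]; simp [hz]
    simp only [hγ, this]
    exact hM.radialPoint_sub ho hp
  have e2 : γ (-1) = q := by
    have : z (-1) = q - o := by rw [hqo]; simp [hz]
    simp only [hγ, this]
    exact hM.radialPoint_sub ho hq
  rw [e1, e2] at hconst
  rw [inner_sub_left, hconst, sub_self]

theorem exists_normal_sub_eq_smul (hM : IsC2StrictlyConvexClosedSurface M)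
    (humb : ∀ U f ν, IsNormalChart M U f ν → ∀ p ∈ U, p ∈ M → IsUmbilic ν p)
    {n : E3 → E3} (hn : ∀ p ∈ M, IsOuterNormal (convexBody M) p (n p)) {p q : E3}
    (hp : p ∈ M) (hq : q ∈ M) : ∃ μ : ℝ, n p - n q = μ • (p - q) := by
  have h : n p - n q ∈ ((ℝ ∙ (p - q))ᗮ)ᗮ := by
    rw [Submodule.mem_orthogonal]
    intro e he
    rw [Submodule.mem_orthogonal_singleton_iff_inner_right] at he
    rw [real_inner_comm]
    exact hM.inner_normal_sub_eq_zero humb hn hp hq he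
  rw [Submodule.orthogonal_orthogonal, Submodule.mem_span_singleton] at h
  obtain ⟨μ, hμ⟩ := h
  exact ⟨μ, hμ.symm⟩

theorem nonempty (hM : IsC2StrictlyConvexClosedSurface M) : M.Nonempty := by
  have := hM.interior_nonempty
  rw [← convexHull_nonempty_iff (𝕜 := ℝ)]
  exact this.mono interior_subset

/-- The normals at `p` and `r` force `0 < k < 1`; the normal at the middle point `q` would then be
negative on two opposite directions. -/
theorem eq_smul_of_three {p q r : E3} (hM : IsC2StrictlyConvexClosedSurface M)
    (hp : p ∈ M) (hq : q ∈ M) (hr : r ∈ M) (hpq : p ≠ q) (hpr : p ≠ r) (hqr : q ≠ r) {k : ℝ}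
    (h : q - p = k • (r - p)) : False := by
  obtain ⟨np, hnp⟩ := hM.exists_isOuterNormal hp
  obtain ⟨nq, hnq⟩ := hM.exists_isOuterNormal hq
  obtain ⟨nr, hnr⟩ := hM.exists_isOuterNormal hr
  have a1 := hM.inner_neg hp hnp (subset_convexBody M hq) hpq.symm
  have a2 := hM.inner_neg hp hnp (subset_convexBody M hr) hpr.symm
  have b1 := hM.inner_neg hq hnq (subset_convexBody M hp) hpq
  have b2 := hM.inner_neg hq hnq (subset_convexBody M hr) hqr.symm
  have c1 := hM.inner_neg hr hnr (subset_convexBody M hp) hpr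
  have c2 := hM.inner_neg hr hnr (subset_convexBody M hq) hqr
  have e1 : q = p + k • (r - p) := by rw [← h]; abel
  have f1 : p - q = (-k) • (r - p) := by rw [e1]; module
  have f2 : r - q = (1 - k) • (r - p) := by rw [e1]; module
  have f3 : q - r = (1 - k) • (p - r) := by rw [e1]; module
  rw [h, real_inner_smul_right] at a1
  rw [f1, real_inner_smul_right] at b1
  rw [f2, real_inner_smul_right] at b2
  rw [f3, real_inner_smul_right] at c2
  have k1 : 0 < k := by by_contra! hk; nlinarith
  have k2 : 0 < 1 - k := by by_contra! hk; nlinarith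
  have d1 : 0 < ⟪nq, r - p⟫ := by by_contra! hk; nlinarith
  nlinarith

/-- Combining the relations gives `(μ'' - μ) • (q - p) = (μ'' - μ') • (r - p)`, and the points are
not collinear. -/
theorem normal_sub_unique_ratio (hM : IsC2StrictlyConvexClosedSurface M) {n : E3 → E3} {p q r : E3}
    (hp : p ∈ M) (hq : q ∈ M) (hr : r ∈ M) (hpq : p ≠ q) (hpr : p ≠ r) {μ μ' μ'' : ℝ}
    (h₁ : n q - n p = μ • (q - p)) (h₂ : n r - n p = μ' • (r - p))
    (h₃ : n r - n q = μ'' • (r - q)) : μ = μ' := by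
  rcases eq_or_ne q r with rfl | hqr
  · rw [h₁] at h₂
    have := sub_ne_zero.2 hpq.symm
    exact smul_left_injective ℝ this h₂
  have e : (μ'' - μ) • (q - p) = (μ'' - μ') • (r - p) := by
    have e1 : n r - n p - (n q - n p) = n r - n q := by abel
    rw [h₁, h₂, h₃] at e1
    have e2 : μ'' • (r - q) = μ'' • (r - p) - μ'' • (q - p) := by module
    rw [e2] at e1
    rw [sub_smul, sub_smul]
    rw [sub_eq_sub_iff_add_eq_add] at e1 ⊢
    rw [add_comm]
    exact e1
  by_cases h0 : μ'' - μ = 0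
  · rw [h0, zero_smul] at e
    have := (smul_eq_zero.1 e.symm).resolve_right (sub_ne_zero.2 hpr.symm)
    linarith
  · exfalso
    refine hM.eq_smul_of_three hp hq hr hpq hpr hqr (k := (μ'' - μ)⁻¹ * (μ'' - μ')) ?_
    rw [mul_smul, ← e, smul_smul, inv_mul_cancel₀ h0, one_smul]

/-- A ray from a point inside the ball meets the sphere only once, so the radial point towards `x`
is `x`. -/
theorem eq_sphere_of_subset_sphere (hM : IsC2StrictlyConvexClosedSurface M) {c : E3} {r : ℝ}
    (hr : 0 < r) (h : M ⊆ Metric.sphere c r) : M = Metric.sphere c r := by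
  have hK : convexBody M ⊆ Metric.closedBall c r :=
    convexHull_min (h.trans Metric.sphere_subset_closedBall) (convex_closedBall c r)
  obtain ⟨o, ho⟩ := hM.interior_nonempty
  have hoc : o ∈ Metric.ball c r := by
    rw [← interior_closedBall c hr.ne']
    exact interior_mono hK ho
  refine h.antisymm fun x hx => ?_
  have hxo : x - o ≠ 0 := by
    intro h0
    rw [sub_eq_zero] at h0
    rw [h0, Metric.mem_sphere] at hx
    rw [Metric.mem_ball] at hoc
    exact hoc.ne hx
  have hq := hM.radialPoint_mem ho hxo
  have hg := hM.bodyGauge_pos ho hxo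
  have hqs := h hq
  set q := radialPoint M o (x - o) with hqdef
  have hint : ∀ y₁ ∈ Metric.closedBall c r, ∀ s : ℝ, 0 ≤ s → s < 1 →
      o + s • (y₁ - o) ∈ Metric.ball c r := by
    intro y₁ hy₁ s hs0 hs1
    have := (convex_closedBall c r).combo_interior_closure_mem_interior (x := o) (y := y₁)
      (a := 1 - s) (b := s) (by rwa [interior_closedBall c hr.ne'])
      (subset_closure hy₁) (by linarith) hs0 (by ring)
    rw [interior_closedBall c hr.ne'] at this
    convert this using 1
    module
  have hqe : q = o + (bodyGauge M o (x - o))⁻¹ • (x - o) := rfl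
  have hone : bodyGauge M o (x - o) = 1 := by
    rcases lt_trichotomy (bodyGauge M o (x - o)) 1 with h1 | h1 | h1
    · exfalso
      have h2 := hint q (Metric.sphere_subset_closedBall hqs) _ hg.le h1
      rw [hqe, add_sub_cancel_left, smul_smul, mul_inv_cancel₀ hg.ne', one_smul,
        add_sub_cancel] at h2
      exact (Metric.mem_ball.1 h2).ne hx
    · exact h1
    · exfalso
      have h2 := hint x (Metric.sphere_subset_closedBall hx) _ (inv_nonneg.2 hg.le)
        (inv_lt_one_of_one_lt₀ h1)
      exact (Metric.mem_ball.1 h2).ne hqs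
  have := (hM.bodyGauge_eq_one_iff ho).1 hone
  simpa using this

theorem exists_eq_sphere_of_isUmbilic (hM : IsC2StrictlyConvexClosedSurface M)
    (humb : ∀ U f ν, IsNormalChart M U f ν → ∀ p ∈ U, p ∈ M → IsUmbilic ν p) :
    ∃ (c : E3) (r : ℝ), 0 < r ∧ M = Metric.sphere c r := by
  choose! n hn using fun p (hp : p ∈ M) => hM.exists_isOuterNormal hp
  obtain ⟨p, hp⟩ := hM.nonempty
  obtain ⟨o, ho⟩ := hM.interior_nonempty
  have hpo : p - o ≠ 0 := by
    intro h0
    rw [sub_eq_zero] at h0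
    exact hM.notMem_interior hp (h0 ▸ ho)
  have hq := hM.radialPoint_mem ho (neg_ne_zero.2 hpo)
  set q := radialPoint M o (-(p - o))
  have hqp : q ≠ p := by
    intro h0
    have h1 : q = o + (bodyGauge M o (-(p - o)))⁻¹ • (-(p - o)) := rfl
    rw [h0] at h1
    have h2 : (1 + (bodyGauge M o (-(p - o)))⁻¹) • (p - o) = 0 := by
      rw [add_smul, one_smul]
      nth_rewrite 1 [h1]
      module
    have h3 := hM.bodyGauge_pos ho (neg_ne_zero.2 hpo)
    have h4 : 0 < 1 + (bodyGauge M o (-(p - o)))⁻¹ := by positivity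
    exact smul_ne_zero h4.ne' hpo h2
  obtain ⟨μ, hμ⟩ := hM.exists_normal_sub_eq_smul humb hn hq hp
  have hall : ∀ x ∈ M, n x - n p = μ • (x - p) := by
    intro x hx
    rcases eq_or_ne x p with rfl | hxp
    · simp
    obtain ⟨μ', hμ'⟩ := hM.exists_normal_sub_eq_smul humb hn hx hp
    obtain ⟨μ'', hμ''⟩ := hM.exists_normal_sub_eq_smul humb hn hx hq
    rw [hM.normal_sub_unique_ratio hp hq hx hqp.symm hxp.symm hμ hμ' hμ'']
    exact hμ'
  have hμ0 : 0 < μ := by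
    have a1 := hM.inner_neg hp (hn p hp) (subset_convexBody M hq) hqp
    have a2 := hM.inner_neg hq (hn q hq) (subset_convexBody M hp) hqp.symm
    rw [← neg_sub, inner_neg_right] at a2
    have a3 : ⟪n q - n p, q - p⟫ = μ * ‖q - p‖ ^ 2 := by
      rw [hμ, real_inner_smul_left, real_inner_self_eq_norm_sq]
    rw [inner_sub_left] at a3
    have a4 : 0 < μ * ‖q - p‖ ^ 2 := by linarith
    exact pos_of_mul_pos_left a4 (by positivity)
  refine ⟨p - μ⁻¹ • n p, μ⁻¹, inv_pos.2 hμ0, hM.eq_sphere_of_subset_sphere (inv_pos.2 hμ0) ?_⟩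
  intro x hx
  rw [Metric.mem_sphere, dist_eq_norm]
  have e : x - (p - μ⁻¹ • n p) = μ⁻¹ • n x := by
    have e1 : n x = n p + μ • (x - p) := by rw [← hall x hx]; abel
    rw [e1, smul_add, smul_smul, inv_mul_cancel₀ hμ0.ne', one_smul]
    abel
  rw [e, norm_smul, (hn x hx).1, mul_one, Real.norm_eq_abs, abs_of_pos (inv_pos.2 hμ0)]

end IsC2StrictlyConvexClosedSurface

/-! ### Planar sections and their tangents. -/

theorem exists_eq_smul_add_smul {m u v w : E3} (hm : m ≠ 0) (hu : ⟪m, u⟫ = 0) (hv : ⟪m, v⟫ = 0)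
    (hw : ⟪m, w⟫ = 0) (hu0 : u ≠ 0) (huv : ∀ k : ℝ, k • u ≠ v) :
    ∃ β γ : ℝ, β • u + γ • v = w := by
  have hli : LinearIndependent ℝ ![u, v] := (LinearIndependent.pair_iff' hu0).2 huv
  have hr : Set.range ![u, v] = {u, v} := by simp [Set.pair_comm]
  have h1 : Module.finrank ℝ (Submodule.span ℝ {u, v}) = 2 := by
    rw [← hr]
    simpa using finrank_span_eq_card hli
  have : Fact (Module.finrank ℝ E3 = 2 + 1) := ⟨by simp⟩
  have h2 : Module.finrank ℝ (ℝ ∙ m)ᗮ = 2 := Submodule.finrank_orthogonal_span_singleton hm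
  have h3 : Submodule.span ℝ {u, v} = (ℝ ∙ m)ᗮ := by
    refine Submodule.eq_of_le_of_finrank_eq (Submodule.span_le.2 ?_) (h1.trans h2.symm)
    rintro x (rfl | rfl)
    · exact Submodule.mem_orthogonal_singleton_iff_inner_right.2 hu
    · exact Submodule.mem_orthogonal_singleton_iff_inner_right.2 hv
  have h4 : w ∈ Submodule.span ℝ {u, v} := by
    rw [h3]
    exact Submodule.mem_orthogonal_singleton_iff_inner_right.2 hw
  exact Submodule.mem_span_pair.1 h4

namespace IsC2StrictlyConvexClosedSurface

variable {M : Set E3}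

/-- A planar section has at most two points whose tangent planes pass through a given point
`ω⁻¹ • y` of the plane, which is a point at infinity if `ω = 0`. -/
theorem not_three_contacts_in_plane (hM : IsC2StrictlyConvexClosedSurface M) {n : E3 → E3}
    (hn : ∀ p ∈ M, IsOuterNormal (convexBody M) p (n p)) {m y p q r : E3} {c ω : ℝ} (hm : m ≠ 0)
    (hyω : ω = 0 → y ≠ 0) (hp : p ∈ M) (hq : q ∈ M) (hr : r ∈ M)
    (hpq : p ≠ q) (hpr : p ≠ r) (hqr : q ≠ r) (hmp : ⟪m, p⟫ = c) (hmq : ⟪m, q⟫ = c)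
    (hmr : ⟪m, r⟫ = c) (hmy : ⟪m, y⟫ = ω * c) (hyp : ⟪n p, ω • p - y⟫ = 0)
    (hyq : ⟪n q, ω • q - y⟫ = 0) (hyr : ⟪n r, ω • r - y⟫ = 0) : False := by
  -- Homogeneous barycentric coordinates: `ω - β - γ`, `β`, `γ` are the weights of `y` at `p`, `q`,
  -- `r`, with sum `ω`.
  obtain ⟨β, γ, h⟩ := exists_eq_smul_add_smul (u := q - p) (v := r - p) (w := y - ω • p) hm
    (by rw [inner_sub_right, hmp, hmq, sub_self]) (by rw [inner_sub_right, hmp, hmr, sub_self])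
    (by rw [inner_sub_right, real_inner_smul_right, hmp, hmy, sub_self])
    (sub_ne_zero.2 hpq.symm) (fun k hk => hM.eq_smul_of_three hp hr hq hpr hpq hqr.symm hk.symm)
  have a1 := hM.inner_neg hp (hn p hp) (subset_convexBody M hq) hpq.symm
  have a2 := hM.inner_neg hp (hn p hp) (subset_convexBody M hr) hpr.symm
  have b1 := hM.inner_neg hq (hn q hq) (subset_convexBody M hp) hpq
  have b2 := hM.inner_neg hq (hn q hq) (subset_convexBody M hr) hqr.symm
  have c1 := hM.inner_neg hr (hn r hr) (subset_convexBody M hp) hpr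
  have c2 := hM.inner_neg hr (hn r hr) (subset_convexBody M hq) hqr
  have ep : β * ⟪n p, q - p⟫ + γ * ⟪n p, r - p⟫ = 0 := by
    rw [← real_inner_smul_right, ← real_inner_smul_right, ← inner_add_right, h, ← neg_sub,
      inner_neg_right, hyp, neg_zero]
  have eq : (ω - β - γ) * ⟪n q, p - q⟫ + γ * ⟪n q, r - q⟫ = 0 := by
    rw [← real_inner_smul_right, ← real_inner_smul_right, ← inner_add_right]
    have : (ω - β - γ) • (p - q) + γ • (r - q) = -(ω • q - y) := by
      have h' : y = β • (q - p) + γ • (r - p) + ω • p := by rw [h]; abel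
      rw [h']; module
    rw [this, inner_neg_right, hyq, neg_zero]
  have er : (ω - β - γ) * ⟪n r, p - r⟫ + β * ⟪n r, q - r⟫ = 0 := by
    rw [← real_inner_smul_right, ← real_inner_smul_right, ← inner_add_right]
    have : (ω - β - γ) • (p - r) + β • (q - r) = -(ω • r - y) := by
      have h' : y = β • (q - p) + γ • (r - p) + ω • p := by rw [h]; abel
      rw [h']; module
    rw [this, inner_neg_right, hyr, neg_zero]
  have key : ∀ {x z s t : ℝ}, s < 0 → t < 0 → x * s + z * t = 0 → x * z ≤ 0 := by
    intro x z s t hs ht h0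
    by_contra! hxz
    rcases pos_and_pos_or_neg_and_neg_of_mul_pos hxz with ⟨hx, hz⟩ | ⟨hx, hz⟩ <;> nlinarith
  have key' : ∀ {x z s t : ℝ}, t < 0 → x * s + z * t = 0 → x = 0 → z = 0 := by
    intro x z s t ht h0 hx
    rw [hx, zero_mul, zero_add] at h0
    exact (mul_eq_zero.1 h0).resolve_right ht.ne
  have k1 := key a1 a2 ep
  have k2 := key b1 b2 eq
  have k3 := key c1 c2 er
  -- The pairwise products of the weights are nonpositive, which is impossible for three nonzero
  -- reals, and one zero weight makes all of them zero.
  have hβ : β = 0 := by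
    by_contra hβ
    have hγ : γ ≠ 0 := fun h0 => hβ (key' a1 (by rw [add_comm]; exact ep) h0)
    have hα : ω - β - γ ≠ 0 := fun h0 => hβ (key' c2 er h0)
    rcases lt_or_gt_of_ne hβ with h1 | h1 <;> rcases lt_or_gt_of_ne hγ with h2 | h2 <;>
      rcases lt_or_gt_of_ne hα with h3 | h3 <;> nlinarith
  have hγ : γ = 0 := key' a2 ep hβ
  have hα : ω - β - γ = 0 := by
    rw [hβ, zero_mul, add_zero] at er
    rw [hβ]
    exact (mul_eq_zero.1 er).resolve_right c1.ne
  have hω : ω = 0 := by rw [hβ, hγ] at hα; linarith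
  apply hyω hω
  rw [hβ, hγ, hω] at h
  simpa using h.symm

/-- The line through `p` directed by `w` lies in the plane; its radial projection from `o` is
injective and continuous, so infinitely many image points fall in `W`. -/
theorem exists_three_points_in_plane (hM : IsC2StrictlyConvexClosedSurface M) {p o m : E3}
    (hp : p ∈ M) (ho : o ∈ interior (convexBody M)) (hmo : ⟪m, o⟫ = ⟪m, p⟫)
    {W : Set E3} (hW : W ∈ 𝓝 p) : ∃ q₁ q₂ q₃, q₁ ≠ q₂ ∧ q₁ ≠ q₃ ∧ q₂ ≠ q₃ ∧
      ∀ q, q = q₁ ∨ q = q₂ ∨ q = q₃ → q ∈ M ∧ q ∈ W ∧ ⟪m, q⟫ = ⟪m, p⟫ := by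
  obtain ⟨w, hw0, hmw, hpw⟩ := exists_ne_zero_inner_eq_zero m (p - o)
  have hpo : p - o ≠ 0 := by
    intro h0
    rw [sub_eq_zero] at h0
    exact hM.notMem_interior hp (h0 ▸ ho)
  set z : ℝ → E3 := fun t => p - o + t • w with hz
  have hin : ∀ t, ⟪p - o, z t⟫ = ‖p - o‖ ^ 2 := by
    intro t
    simp only [hz, inner_add_right, real_inner_smul_right, hpw, real_inner_self_eq_norm_sq]
    ring
  have hpos : 0 < ‖p - o‖ ^ 2 := pow_pos (norm_pos_iff.2 hpo) 2
  have hz0 : ∀ t, z t ≠ 0 := by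
    intro t h0
    have := hin t
    rw [h0, inner_zero_right] at this
    exact hpos.ne this
  set γ : ℝ → E3 := fun t => radialPoint M o (z t) with hγ
  have hγ0 : γ 0 = p := by
    have : z 0 = p - o := by simp [hz]
    simp only [hγ, this]
    exact hM.radialPoint_sub ho hp
  have hcont : ContinuousAt γ 0 :=
    ContinuousAt.comp (f := z) (hM.continuousAt_radialPoint ho (hz0 0))
      (by fun_prop)
  have hinj : Function.Injective γ := by
    intro s t hst
    simp only [hγ, radialPoint, add_right_inj] at hst
    have h1 := congrArg (fun x => ⟪p - o, x⟫) hst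
    simp only [real_inner_smul_right, hin] at h1
    have h2 := mul_right_cancel₀ hpos.ne' h1
    rw [h2] at hst
    have h3 := smul_right_injective E3
      (inv_ne_zero (hM.bodyGauge_pos ho (hz0 t)).ne') hst
    simp only [hz, add_right_inj] at h3
    exact smul_left_injective ℝ hw0 h3
  have hinf : (γ '' (γ ⁻¹' W)).Infinite := by
    refine Set.Infinite.image hinj.injOn ?_
    exact infinite_of_mem_nhds (0 : ℝ) (hcont (by rwa [hγ0]))
  obtain ⟨t, hts, htc⟩ := hinf.exists_subset_card_eq 3
  obtain ⟨q₁, q₂, q₃, h₁₂, h₁₃, h₂₃, rfl⟩ := Finset.card_eq_three.1 htc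
  refine ⟨q₁, q₂, q₃, h₁₂, h₁₃, h₂₃, fun q hq => ?_⟩
  obtain ⟨s, hs, rfl⟩ := hts (show q ∈ (({q₁, q₂, q₃} : Finset E3) : Set E3) by simpa using hq)
  refine ⟨hM.radialPoint_mem ho (hz0 s), hs, ?_⟩
  simp only [hγ, radialPoint, hz, inner_add_right, real_inner_smul_right, inner_sub_right, hmw, hmo]
  ring

/-- Otherwise a section by a plane parallel to `d` has three tangents through the point at infinity
`d`. -/
theorem exists_inner_normal_ne_zero (hM : IsC2StrictlyConvexClosedSurface M) {n : E3 → E3}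
    (hn : ∀ p ∈ M, IsOuterNormal (convexBody M) p (n p)) {d p : E3} (hd : d ≠ 0) (hp : p ∈ M)
    {W : Set E3} (hW : W ∈ 𝓝 p) : ∃ q ∈ M, q ∈ W ∧ ⟪n q, d⟫ ≠ 0 := by
  obtain ⟨o, ho⟩ := hM.interior_nonempty
  obtain ⟨m, hm, hmd, hmp⟩ := exists_ne_zero_inner_eq_zero d (p - o)
  rw [real_inner_comm] at hmd hmp
  obtain ⟨q₁, q₂, q₃, h₁₂, h₁₃, h₂₃, hq⟩ := hM.exists_three_points_in_plane hp ho
    (m := m) (by rw [inner_sub_right] at hmp; linarith) hW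
  by_contra! h
  have h' : ∀ q, q = q₁ ∨ q = q₂ ∨ q = q₃ → ⟪n q, (0 : ℝ) • q - d⟫ = 0 := fun q hq' => by
    rw [zero_smul, zero_sub, inner_neg_right, h q (hq q hq').1 (hq q hq').2.1, neg_zero]
  exact hM.not_three_contacts_in_plane hn (y := d) (ω := 0) hm (fun _ => hd)
    (hq q₁ (by simp)).1 (hq q₂ (by simp)).1 (hq q₃ (by simp)).1 h₁₂ h₁₃ h₂₃
    (hq q₁ (by simp)).2.2 (hq q₂ (by simp)).2.2 (hq q₃ (by simp)).2.2 (by rw [hmd, zero_mul])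
    (h' q₁ (by simp)) (h' q₂ (by simp)) (h' q₃ (by simp))

/-- A flat piece, cut by a plane through `p` and an interior point, would contain three collinear
points. -/
theorem exists_notMem_plane (hM : IsC2StrictlyConvexClosedSurface M) {m p : E3} {c : ℝ}
    (hm : m ≠ 0) (hp : p ∈ M) {W : Set E3} (hW : W ∈ 𝓝 p) : ∃ q ∈ M, q ∈ W ∧ ⟪m, q⟫ ≠ c := by
  obtain ⟨o, ho⟩ := hM.interior_nonempty
  obtain ⟨l, hl, hlm, hlp⟩ := exists_ne_zero_inner_eq_zero m (p - o)
  rw [real_inner_comm] at hlp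
  obtain ⟨q₁, q₂, q₃, h₁₂, h₁₃, h₂₃, hq⟩ := hM.exists_three_points_in_plane hp ho
    (m := l) (by rw [inner_sub_right] at hlp; linarith) hW
  by_contra! h
  have hm' : ∀ q, q = q₁ ∨ q = q₂ ∨ q = q₃ → ⟪m, q⟫ = c := fun q hq' =>
    h q (hq q hq').1 (hq q hq').2.1
  have k1 := hq q₁ (by simp)
  have k2 := hq q₂ (by simp)
  have k3 := hq q₃ (by simp)
  obtain ⟨β, γ, e⟩ := exists_eq_smul_add_smul (u := q₂ - q₁) (v := q₃ - q₁) (w := l) hm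
    (by rw [inner_sub_right, hm' q₁ (by simp), hm' q₂ (by simp), sub_self])
    (by rw [inner_sub_right, hm' q₁ (by simp), hm' q₃ (by simp), sub_self]) hlm
    (sub_ne_zero.2 h₁₂.symm)
    (fun k hk => hM.eq_smul_of_three k1.1 k3.1 k2.1 h₁₃ h₁₂ h₂₃.symm hk.symm)
  have h0 : ⟪l, β • (q₂ - q₁) + γ • (q₃ - q₁)⟫ = 0 := by
    rw [inner_add_right, real_inner_smul_right, real_inner_smul_right, inner_sub_right,
      inner_sub_right, k1.2.2, k2.2.2, k3.2.2]
    ring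
  rw [e, inner_self_eq_zero] at h0
  exact hl h0

end IsC2StrictlyConvexClosedSurface

/-! ### Lines in the equitangent set. -/

/-- A multiple of the vector from `q` to the intersection of the line through `a` directed by `d`
with the plane through `q` orthogonal to `n`. -/
noncomputable def tangentDirection (n a d q : E3) : E3 := ⟪n, d⟫ • (q - a) - ⟪n, q - a⟫ • d

theorem inner_tangentDirection (n a d q : E3) : ⟪n, tangentDirection n a d q⟫ = 0 := by
  rw [tangentDirection, inner_sub_right, real_inner_smul_right, real_inner_smul_right]
  ring

/-- The denominator `⟪n, d⟫` is cleared in the definition so that the direction stays continuous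
where the tangent plane is parallel to the line. -/
theorem tangentDirection_eq_smul {n a d q : E3} (h : ⟪n, d⟫ ≠ 0) :
    tangentDirection n a d q = ⟪n, d⟫ • (q - (a + (⟪n, q - a⟫ / ⟪n, d⟫) • d)) := by
  rw [tangentDirection, ← sub_sub, smul_sub _ (q - a), smul_smul, mul_div_cancel₀ _ h]

namespace IsC2StrictlyConvexClosedSurface

variable {M : Set E3}

theorem continuous_normal (hM : IsC2StrictlyConvexClosedSurface M) {n : E3 → E3}
    (hn : ∀ p ∈ M, IsOuterNormal (convexBody M) p (n p)) : Continuous fun p : M => n p := by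
  rw [continuous_iff_continuousAt]
  rintro ⟨p, hp⟩
  obtain ⟨U, f, ν, hU, hch⟩ := hM.exists_isNormalChart hp
  have h1 : ContinuousAt (fun q : M => ν q) ⟨p, hp⟩ :=
    ContinuousAt.comp (g := ν) (hch.contDiffAt p hU).continuousAt continuous_subtype_val.continuousAt
  refine h1.congr ?_
  have h2 : ∀ᶠ q : M in 𝓝 ⟨p, hp⟩, (q : E3) ∈ U :=
    continuous_subtype_val.continuousAt.eventually_mem (hch.isOpen.mem_nhds hU)
  filter_upwards [h2] with q hq
  exact (hch.eq_of_isOuterNormal q hq q.2 _ (hn q q.2)).symm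

theorem dense_of_forall_nhds {G : Set M}
    (h : ∀ p ∈ M, ∀ W ∈ 𝓝 p, ∃ q, ∃ hq : q ∈ M, q ∈ W ∧ (⟨q, hq⟩ : M) ∈ G) :
    Dense G := by
  rintro ⟨p, hp⟩
  rw [mem_closure_iff_nhds]
  intro t ht
  rw [nhds_subtype_eq_comap, mem_comap] at ht
  obtain ⟨W, hW, hWt⟩ := ht
  obtain ⟨q, hq, hqW, hqG⟩ := h p hp W hW
  exact ⟨⟨q, hq⟩, hWt hqW, hqG⟩

theorem isPrincipalDirection_tangentDirection
    {U : Set E3} {f : E3 → ℝ} {ν : E3 → E3} (hch : IsNormalChart M U f ν) {q a d : E3}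
    (hqU : q ∈ U) (hq : q ∈ M) (hH : ∀ t : ℝ, a + t • d ∈ equitangentSet M)
    (hd : ⟪ν q, d⟫ ≠ 0) : IsPrincipalDirection ν q (tangentDirection (ν q) a d q) := by
  have e := tangentDirection_eq_smul (q := q) (a := a) hd
  have e' : (⟪ν q, d⟫)⁻¹ • tangentDirection (ν q) a d q =
      q - (a + (⟪ν q, q - a⟫ / ⟪ν q, d⟫) • d) := by
    rw [e, smul_smul, inv_mul_cancel₀ hd, one_smul]
  refine IsPrincipalDirection.of_smul (inv_ne_zero hd) ?_
  rw [e']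
  refine hch.isPrincipalDirection hqU hq (hH _) ?_
  rw [← e', real_inner_smul_right, inner_tangentDirection, mul_zero]

/-- The plane with normal `m` contains `q` and the first line, hence the first direction; the
second, being parallel to it, leads to a point of the second line in the same plane. -/
theorem eq_of_not_linearIndependent_tangentDirection {n q a d a' d' : E3} {m : E3}
    (hd : ⟪n, d⟫ ≠ 0) (hd' : ⟪n, d'⟫ ≠ 0)
    (hqa : ∀ t : ℝ, q ≠ a + t • d)
    (hmd : ⟪m, d⟫ = 0) (hmq : ⟪m, q⟫ = ⟪m, a⟫)
    (hli : ¬ LinearIndependent ℝ ![tangentDirection n a d q, tangentDirection n a' d' q]) :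
    ∃ t : ℝ, ⟪m, a' + t • d'⟫ = ⟪m, a⟫ ∧ ⟪n, q - (a' + t • d')⟫ = 0 := by
  set U := tangentDirection n a d q with hU
  set U' := tangentDirection n a' d' q with hU'
  have hU0 : U ≠ 0 := by
    rw [hU, tangentDirection_eq_smul hd]
    exact smul_ne_zero hd (sub_ne_zero.2 (hqa _))
  rw [LinearIndependent.pair_iff' hU0] at hli
  push Not at hli
  obtain ⟨k, hk⟩ := hli
  have hmU : ⟪m, U⟫ = 0 := by
    rw [hU, tangentDirection, inner_sub_right, real_inner_smul_right, real_inner_smul_right, hmd,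
      inner_sub_right, hmq]
    ring
  have hmU' : ⟪m, U'⟫ = 0 := by rw [← hk, real_inner_smul_right, hmU, mul_zero]
  have hnU' : ⟪n, U'⟫ = 0 := inner_tangentDirection n a' d' q
  rw [hU', tangentDirection_eq_smul hd', real_inner_smul_right] at hmU' hnU'
  refine ⟨⟪n, q - a'⟫ / ⟪n, d'⟫, ?_, (mul_eq_zero.1 hnU').resolve_left hd'⟩
  have := (mul_eq_zero.1 hmU').resolve_left hd'
  rw [inner_sub_right] at this
  linarith

theorem dense_linearIndependent_tangentDirection (hM : IsC2StrictlyConvexClosedSurface M)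
    {n : E3 → E3} (hn : ∀ p ∈ M, IsOuterNormal (convexBody M) p (n p)) {a d a' d' : E3}
    (hd : d ≠ 0) (hd' : d' ≠ 0) (hH : ∀ t : ℝ, a + t • d ∈ equitangentSet M)
    {s : ℝ} (hs : ∀ t : ℝ, a' + s • d' ≠ a + t • d) :
    Dense {p : M | LinearIndependent ℝ
      ![tangentDirection (n p) a d p, tangentDirection (n p) a' d' p]} := by
  have hcn := hM.continuous_normal hn
  have hG : ∀ v : E3, v ≠ 0 → IsOpen {p : M | ⟪n p, v⟫ ≠ 0} ∧ Dense {p : M | ⟪n p, v⟫ ≠ 0} :=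
    fun v hv => ⟨isOpen_ne_fun (hcn.inner (𝕜 := ℝ) continuous_const) continuous_const,
      dense_of_forall_nhds fun p hp W hW => by
        obtain ⟨q, hq, hqW, hqn⟩ := hM.exists_inner_normal_ne_zero hn hv hp hW
        exact ⟨q, hq, hqW, hqn⟩⟩
  set b : E3 := a' + s • d' - a with hb
  -- For `p` off the plane with normal `l`, the plane through `p` and the first line misses the
  -- point `a' + s • d'`.
  obtain ⟨l, hl, hdl, hbl⟩ := exists_ne_zero_inner_eq_zero d b
  rw [real_inner_comm] at hdl hbl
  have hN : Dense {p : M | ⟪l, (p : E3)⟫ ≠ ⟪l, a⟫} := dense_of_forall_nhds fun p hp W hW => by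
    obtain ⟨q, hq, hqW, hqn⟩ := hM.exists_notMem_plane (c := ⟪l, a⟫) hl hp hW
    exact ⟨q, hq, hqW, hqn⟩
  have hGG := ((hG d hd).1.inter (hG d' hd').1)
  have hD := hN.inter_of_isOpen_right ((hG d hd).2.inter_of_isOpen_left (hG d' hd').2 (hG d hd).1)
    hGG
  refine dense_of_forall_nhds fun p₁ hp₁ W hW => ?_
  obtain ⟨⟨p, hp⟩, hpW, hpl, hpd⟩ := mem_closure_iff_nhds.1 (hD ⟨p₁, hp₁⟩)
    ((fun q : M => (q : E3)) ⁻¹' interior W)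
    (continuous_subtype_val.continuousAt (isOpen_interior.mem_nhds (mem_interior_iff_mem_nhds.2 hW)))
  have hW' := hGG.mem_nhds hpd
  rw [nhds_subtype_eq_comap, mem_comap] at hW'
  obtain ⟨V, hV, hVG⟩ := hW'
  obtain ⟨m, hm, hdm, hpm⟩ := exists_ne_zero_inner_eq_zero d (p - a)
  rw [real_inner_comm] at hdm hpm
  have hmp : ⟪m, p⟫ = ⟪m, a⟫ := by rw [inner_sub_right] at hpm; linarith
  have hmb : ⟪m, b⟫ ≠ 0 := by
    intro h0
    obtain ⟨β, γ, e⟩ := exists_eq_smul_add_smul hm hdm h0 hpm hd (fun k hk => hs k (by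
      rw [hk, hb]; abel))
    apply hpl
    have := congrArg (fun x => ⟪l, x⟫) e
    simp only [inner_add_right, real_inner_smul_right, hdl, hbl, inner_sub_right] at this
    linarith
  obtain ⟨t, ht⟩ := hM.exists_add_smul_mem_interior hp (hn p hp) hpd.1
  obtain ⟨q₁, q₂, q₃, h₁₂, h₁₃, h₂₃, hq⟩ := hM.exists_three_points_in_plane hp ht (m := m)
    (by rw [inner_add_right, real_inner_smul_right, hdm, mul_zero, add_zero])
    (inter_mem (isOpen_interior.mem_nhds hpW) hV)
  by_contra! hbad
  have hc : ∀ q, q = q₁ ∨ q = q₂ ∨ q = q₃ →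
      ∃ t : ℝ, ⟪m, a' + t • d'⟫ = ⟪m, a⟫ ∧ ⟪n q, q - (a' + t • d')⟫ = 0 := by
    intro q hq'
    obtain ⟨hqM, ⟨hqW, hqV⟩, hqm⟩ := hq q hq'
    have hqG := @hVG ⟨q, hqM⟩ hqV
    refine eq_of_not_linearIndependent_tangentDirection hqG.1 hqG.2 ?_ hdm (hqm.trans hmp)
      (hbad q hqM (interior_subset hqW))
    intro t h0
    exact (hH t).1 (h0 ▸ subset_convexBody M hqM)
  obtain ⟨t₁, ht₁, hy₁⟩ := hc q₁ (by simp)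
  -- The second line meets the section plane but is not contained in it, so they cross in a single
  -- point, common to all three contacts.
  have hmd' : ⟪m, d'⟫ ≠ 0 := by
    intro h0
    rw [inner_add_right, real_inner_smul_right, h0] at ht₁
    apply hmb
    rw [hb, inner_sub_right, inner_add_right, real_inner_smul_right, h0]
    linarith
  have hy : ∀ q, q = q₁ ∨ q = q₂ ∨ q = q₃ → ⟪n q, (1 : ℝ) • q - (a' + t₁ • d')⟫ = 0 := by
    intro q hq'
    obtain ⟨t, ht, hy⟩ := hc q hq'
    have : t = t₁ := by
      rw [← ht₁, inner_add_right, inner_add_right, real_inner_smul_right, real_inner_smul_right,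
        add_right_inj] at ht
      exact mul_right_cancel₀ hmd' ht
    rw [one_smul, ← this]
    exact hy
  exact hM.not_three_contacts_in_plane hn (y := a' + t₁ • d') (ω := 1) (c := ⟪m, a⟫) hm (by simp)
    (hq q₁ (by simp)).1 (hq q₂ (by simp)).1 (hq q₃ (by simp)).1 h₁₂ h₁₃ h₂₃
    ((hq q₁ (by simp)).2.2.trans hmp) ((hq q₂ (by simp)).2.2.trans hmp)
    ((hq q₃ (by simp)).2.2.trans hmp) (by rw [ht₁, one_mul])
    (hy q₁ (by simp)) (hy q₂ (by simp)) (hy q₃ (by simp))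

/-- Transversality to each line and independence of each pair of directions are open dense
conditions, so they hold together on a dense set; umbilicity then passes to its closure. -/
theorem isUmbilic_of_three_lines (hM : IsC2StrictlyConvexClosedSurface M) {a d : Fin 3 → E3}
    (hd : ∀ i, d i ≠ 0) (hH : ∀ i, ∀ t : ℝ, a i + t • d i ∈ equitangentSet M)
    (hne : ∀ i j, i ≠ j → ∃ s : ℝ, ∀ t : ℝ, a j + s • d j ≠ a i + t • d i)
    {U : Set E3} {f : E3 → ℝ} {ν : E3 → E3} (hch : IsNormalChart M U f ν) {p : E3}
    (hpU : p ∈ U) (hp : p ∈ M) : IsUmbilic ν p := by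
  choose! n hn using fun p (hp : p ∈ M) => hM.exists_isOuterNormal hp
  have hcn := hM.continuous_normal hn
  have hct : ∀ i, Continuous fun q : M => tangentDirection (n q) (a i) (d i) q := by
    intro i
    unfold tangentDirection
    have h1 : Continuous fun q : M => (q : E3) - a i := by fun_prop
    exact ((hcn.inner (𝕜 := ℝ) continuous_const).smul h1).sub
      ((hcn.inner (𝕜 := ℝ) h1).smul continuous_const)
  have : CompactSpace M := isCompact_iff_compactSpace.1 hM.isCompact
  have hD1 : Dense (⋂ i, {q : M | ⟪n q, d i⟫ ≠ 0}) := by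
    refine dense_iInter_of_isOpen (fun i => ?_) fun i => ?_
    · exact isOpen_ne_fun (hcn.inner (𝕜 := ℝ) continuous_const) continuous_const
    · refine dense_of_forall_nhds fun p hp W hW => ?_
      obtain ⟨q, hq, hqW, hqn⟩ := hM.exists_inner_normal_ne_zero hn (hd i) hp hW
      exact ⟨q, hq, hqW, hqn⟩
  have hO2 : ∀ i : {i : Fin 3 × Fin 3 // i.1 ≠ i.2}, IsOpen {q : M | LinearIndependent ℝ
      ![tangentDirection (n q) (a i.1.1) (d i.1.1) q,
        tangentDirection (n q) (a i.1.2) (d i.1.2) q]} := by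
    intro i
    have h1 : Continuous fun q : M => ![tangentDirection (n q) (a i.1.1) (d i.1.1) q,
        tangentDirection (n q) (a i.1.2) (d i.1.2) q] := by
      refine continuous_pi fun k => ?_
      fin_cases k
      · exact hct _
      · exact hct _
    exact isOpen_setOfPred_linearIndependent.preimage h1
  have hD2 := dense_iInter_of_isOpen hO2 fun i => by
    obtain ⟨s, hs⟩ := hne _ _ i.2
    exact hM.dense_linearIndependent_tangentDirection hn (hd _) (hd _) (hH _) hs
  have hD := hD2.inter_of_isOpen_left hD1 (isOpen_iInter_of_finite hO2)
  refine hch.isUmbilic_of_mem_closure hpU (mem_closure_iff_nhds.2 fun W hW => ?_)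
  obtain ⟨⟨q, hq⟩, hqW, hq2, hq1⟩ := mem_closure_iff_nhds.1 (hD ⟨p, hp⟩)
    ((fun q : M => (q : E3)) ⁻¹' (W ∩ U))
    (continuous_subtype_val.continuousAt (inter_mem hW (hch.isOpen.mem_nhds hpU)))
  refine ⟨q, hqW.1, hqW.2, ?_⟩
  rw [mem_iInter] at hq1 hq2
  have hnν : n q = ν q := hch.eq_of_isOuterNormal q hqW.2 hq _ (hn q hq)
  have hq1' : ∀ i, ⟪ν q, d i⟫ ≠ 0 := fun i => by rw [← hnν]; exact hq1 i
  have hli : ∀ i j, i ≠ j → LinearIndependent ℝ ![tangentDirection (ν q) (a i) (d i) q,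
      tangentDirection (ν q) (a j) (d j) q] := fun i j hij => by
    rw [← hnν]; exact hq2 ⟨(i, j), hij⟩
  have hpr : ∀ i, IsPrincipalDirection ν q (tangentDirection (ν q) (a i) (d i) q) := fun i =>
    isPrincipalDirection_tangentDirection hch hqW.2 hq (hH i) (hq1' i)
  exact isUmbilic_of_three_directions (hch.norm_eq_one q hqW.2) (inner_tangentDirection _ _ _ _)
    (inner_tangentDirection _ _ _ _) (inner_tangentDirection _ _ _ _) (hpr 0) (hpr 1) (hpr 2)
    (hli 0 1 (by decide)) (hli 0 2 (by decide)) (hli 1 2 (by decide))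

/-! ### Enclosing surfaces. -/

theorem isUmbilic_of_closedSurface {S : Set E3}
    (hMS : M ⊆ surfaceInterior S) (hS : S ⊆ equitangentSet M) {U : Set E3} {f : E3 → ℝ}
    {ν : E3 → E3} (hch : IsNormalChart M U f ν) {p : E3} (hpU : p ∈ U) (hp : p ∈ M) :
    IsUmbilic ν p := by
  intro u hu
  rcases eq_or_ne u 0 with rfl | hu0
  · intro w _ _
    exact inner_zero_right _
  obtain ⟨hpS, hb⟩ := hMS hp
  -- A ray avoiding `S` would be an unbounded part of the bounded component of `p`.
  have hray : ∃ k : ℝ, 0 ≤ k ∧ p + k • u ∈ S := by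
    by_contra! h
    set R : Set E3 := (fun k : ℝ => p + k • u) '' Ici 0 with hR
    have h1 : IsPreconnected R := isPreconnected_Ici.image _ (by fun_prop)
    have h2 : R ⊆ connectedComponentIn Sᶜ p := by
      refine h1.subset_connectedComponentIn ⟨0, by simp, by simp⟩ ?_
      rintro _ ⟨k, hk, rfl⟩
      exact h k hk
    obtain ⟨C, hC⟩ := (hb.subset h2).exists_norm_le
    have hu1 := norm_pos_iff.2 hu0
    have h3 := hC _ ⟨(|C| + ‖p‖ + 1) / ‖u‖, by simp only [mem_Ici]; positivity, rfl⟩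
    have h4 : ‖((|C| + ‖p‖ + 1) / ‖u‖) • u‖ = |C| + ‖p‖ + 1 := by
      rw [norm_smul, Real.norm_eq_abs, abs_of_nonneg (by positivity), div_mul_cancel₀ _ hu1.ne']
    have h5 := norm_sub_norm_le (((|C| + ‖p‖ + 1) / ‖u‖) • u) (-p)
    rw [norm_neg, sub_neg_eq_add, add_comm _ p, h4] at h5
    have h6 := le_abs_self C
    linarith
  obtain ⟨k, -, hk⟩ := hray
  have hk0 : k ≠ 0 := by
    rintro rfl
    exact hpS (by simpa using hk)
  refine IsPrincipalDirection.of_smul (neg_ne_zero.2 hk0) ?_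
  have e : (-k) • u = p - (p + k • u) := by rw [neg_smul]; abel
  rw [e]
  refine hch.isPrincipalDirection hpU hp (hS hk) ?_
  rw [← e, real_inner_smul_right, hu, mul_zero]

end IsC2StrictlyConvexClosedSurface

/-! ### Affine subspaces and the three cases. -/

theorem AffineSubspace.exists_coe_eq_range_of_finrank_direction_eq_one {L : AffineSubspace ℝ E3}
    (h : Module.finrank ℝ L.direction = 1) :
    ∃ a d : E3, d ≠ 0 ∧ (L : Set E3) = Set.range fun t : ℝ => a + t • d := by
  have hne : (L : Set E3).Nonempty := by
    rw [AffineSubspace.nonempty_iff_ne_bot]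
    intro h0
    rw [h0, AffineSubspace.direction_bot, finrank_bot] at h
    omega
  obtain ⟨a, ha⟩ := hne
  obtain ⟨⟨d, hdL⟩, hd0, hd⟩ := finrank_eq_one_iff'.1 h
  refine ⟨a, d, fun h0 => hd0 (Subtype.ext h0), Set.ext fun x => ⟨fun hx => ?_, ?_⟩⟩
  · obtain ⟨c, hc⟩ := hd ⟨x - a, AffineSubspace.vsub_mem_direction hx ha⟩
    refine ⟨c, ?_⟩
    have := congrArg Subtype.val hc
    simp only [SetLike.mk_smul_mk] at this
    simp [this]
  · rintro ⟨t, rfl⟩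
    have := AffineSubspace.vadd_mem_of_mem_direction (L.direction.smul_mem t hdL) ha
    simpa [add_comm] using this

theorem AffineSubspace.exists_mem_notMem_of_finrank_direction_eq {L L' : AffineSubspace ℝ E3}
    {k : ℕ} (hk : 0 < k) (h : Module.finrank ℝ L.direction = k)
    (h' : Module.finrank ℝ L'.direction = k) (hne : L ≠ L') : ∃ x ∈ L', x ∉ L := by
  by_contra! hle
  have hL' : (L' : Set E3).Nonempty := by
    rw [AffineSubspace.nonempty_iff_ne_bot]
    intro h0
    rw [h0, AffineSubspace.direction_bot, finrank_bot] at h'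
    omega
  have hle' : L' ≤ L := hle
  have hdir := Submodule.eq_of_le_of_finrank_eq (AffineSubspace.direction_le hle')
    (h'.trans h.symm)
  exact hne (AffineSubspace.eq_of_direction_eq_of_nonempty_of_le hdir hL' hle').symm

theorem theorem1 (M : Set E3) (hM : IsC2StrictlyConvexClosedSurface M)
    (hH :
      (∃ S : Set E3, IsClosedSurface S ∧ M ⊆ surfaceInterior S ∧ S ⊆ equitangentSet M) ∨
      (∃ P : AffineSubspace ℝ E3, Module.finrank ℝ P.direction = 2 ∧
        (P : Set E3) ⊆ equitangentSet M) ∨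
      (∃ L₁ L₂ L₃ : AffineSubspace ℝ E3,
        Module.finrank ℝ L₁.direction = 1 ∧ Module.finrank ℝ L₂.direction = 1 ∧
        Module.finrank ℝ L₃.direction = 1 ∧ L₁ ≠ L₂ ∧ L₁ ≠ L₃ ∧ L₂ ≠ L₃ ∧
        (L₁ : Set E3) ∪ (L₂ : Set E3) ∪ (L₃ : Set E3) ⊆ equitangentSet M)) :
    ∃ (c : E3) (r : ℝ), 0 < r ∧ M = Metric.sphere c r := by
  rcases hH with ⟨S, -, hMS, hS⟩ | ⟨P, hP, hPH⟩ | ⟨L₁, L₂, L₃, h₁, h₂, h₃, h₁₂, h₁₃, h₂₃, hL⟩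
  · exact hM.exists_eq_sphere_of_isUmbilic fun U f ν hch p hpU hp =>
      IsC2StrictlyConvexClosedSurface.isUmbilic_of_closedSurface hMS hS hch hpU hp
  · have hne : (P : Set E3).Nonempty := by
      rw [AffineSubspace.nonempty_iff_ne_bot]
      intro h0
      rw [h0, AffineSubspace.direction_bot, finrank_bot] at hP
      omega
    obtain ⟨x, hx⟩ := hne
    let b := Module.finBasisOfFinrankEq ℝ P.direction hP
    set v : E3 := (b 0 : E3) with hv
    set w : E3 := (b 1 : E3) with hw
    have hli : ∀ s t : ℝ, s • v + t • w = 0 → s = 0 ∧ t = 0 := by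
      have h1 : LinearIndependent ℝ ![v, w] := by
        have := b.linearIndependent.map' P.direction.subtype (Submodule.ker_subtype _)
        have e : ⇑P.direction.subtype ∘ ⇑b = ![v, w] := by
          funext i
          fin_cases i <;> rfl
        rwa [e] at this
      exact LinearIndependent.pair_iff.1 h1
    -- Three pairwise independent directions give three distinct lines through `x` in the plane.
    let d : Fin 3 → E3 := ![v, w, v + w]
    have hdP : ∀ i, d i ∈ P.direction := by
      intro i
      fin_cases i
      · exact (b 0).2
      · exact (b 1).2
      · exact P.direction.add_mem (b 0).2 (b 1).2
    have hind : ∀ i j, i ≠ j → ∀ t : ℝ, d j ≠ t • d i := by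
      have key : ∀ s₁ s₂ t₁ t₂ t : ℝ, s₁ * t₂ - s₂ * t₁ ≠ 0 →
          s₁ • v + s₂ • w ≠ t • (t₁ • v + t₂ • w) := by
        intro s₁ s₂ t₁ t₂ t hne h0
        have := hli (s₁ - t * t₁) (s₂ - t * t₂) (by
          rw [← sub_eq_zero] at h0
          rw [← h0]
          module)
        apply hne
        linear_combination t₂ * this.1 - t₁ * this.2
      intro i j hij t
      fin_cases i <;> fin_cases j <;> first | exact absurd rfl hij | skip
      · simpa [d] using key 0 1 1 0 t (by norm_num)
      · simpa [d] using key 1 1 1 0 t (by norm_num)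
      · simpa [d] using key 1 0 0 1 t (by norm_num)
      · simpa [d] using key 1 1 0 1 t (by norm_num)
      · simpa [d] using key 1 0 1 1 t (by norm_num)
      · simpa [d] using key 0 1 1 1 t (by norm_num)
    refine hM.exists_eq_sphere_of_isUmbilic fun U f ν hch p hpU hp =>
      hM.isUmbilic_of_three_lines (a := fun _ => x) (d := d) (fun i h0 => ?_) (fun i t => hPH ?_)
        (fun i j hij => ⟨1, fun t h0 => ?_⟩) hch hpU hp
    · obtain ⟨j, hj⟩ := exists_ne i
      exact hind j i hj 0 (by rw [h0, zero_smul])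
    · have := AffineSubspace.vadd_mem_of_mem_direction (P.direction.smul_mem t (hdP i)) hx
      simpa [add_comm] using this
    · rw [one_smul, add_right_inj] at h0
      exact hind i j hij t h0
  · let L : Fin 3 → AffineSubspace ℝ E3 := ![L₁, L₂, L₃]
    have hrank : ∀ i, Module.finrank ℝ (L i).direction = 1 := by
      intro i
      fin_cases i
      exacts [h₁, h₂, h₃]
    have hdist : ∀ i j, i ≠ j → L i ≠ L j := by
      intro i j hij
      fin_cases i <;> fin_cases j <;> first | exact absurd rfl hij | skip
      exacts [h₁₂, h₁₃, h₁₂.symm, h₂₃, h₁₃.symm, h₂₃.symm]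
    have hsub : ∀ i, (L i : Set E3) ⊆ equitangentSet M := by
      intro i x hx
      fin_cases i
      exacts [hL (Or.inl (Or.inl hx)), hL (Or.inl (Or.inr hx)), hL (Or.inr hx)]
    choose a d hd hLad using fun i =>
      AffineSubspace.exists_coe_eq_range_of_finrank_direction_eq_one (hrank i)
    refine hM.exists_eq_sphere_of_isUmbilic fun U f ν hch p hpU hp =>
      hM.isUmbilic_of_three_lines (a := a) hd (fun i t => hsub i ?_) (fun i j hij => ?_) hch hpU hp
    · rw [hLad]
      exact ⟨t, rfl⟩
    · obtain ⟨y, hyj, hyi⟩ := AffineSubspace.exists_mem_notMem_of_finrank_direction_eq one_pos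
        (hrank i) (hrank j) (hdist i j hij)
      rw [← SetLike.mem_coe, hLad] at hyj hyi
      obtain ⟨s, rfl⟩ := hyj
      exact ⟨s, fun t h0 => hyi ⟨t, h0.symm⟩⟩
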